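/- **Definitions.** Let $\mathbb F$ be a field and $X=\{x_1,\dots,x_n\}$. An *algebraic branching program* (ABP) $P$ over $\mathbb F$ is a layered directed acyclic graph with layers $L_0=\{s\},L_1,\dots,L_m=\{t\}$; every edge goes from some layer to the next one, there is at most one edge from a node to another, and each edge is labelled by an element of $X\cup\mathbb F$. $P$ computes the polynomial $\sum_\rho \mathrm{wt}(\rho)\in\mathbb F[X]$, where $\rho$ ranges over all $s$–$t$ paths and $\mathrm{wt}(\rho)$ is the product of the edge labels on $\rho$. The *size* of $P$ is its number of nodes. For nodes $u,v$ let $X_{uv}$ be the set of variables that label an edge on some path from $u$ to $v$. For $\pi\in S_n$, a *$\pi$-interval* is a (possibly empty) set $\{x_{\pi(k)} : i\le k\le j\}$. $P$ is a *strict-interval ABP with respect to $\pi$* if every $s$–$t$ path reads every variable at most once and one can choose a $\pi$-interval $I_{uv}\supseteq X_{uv}$ for every pair of nodes $u,v$ such that $I_{uv}\cap I_{vw}=\emptyset$ for all nodes $u,v,w$. **Theorem.** There are a single algorithm and a polynomial $q$ such that for every field $\mathbb F$, every $n$, every $\pi\in S_n$ and every ABP $P$ over $\mathbb F$ in $n$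 variables that is strict-interval with respect to $\pi$, the algorithm, given $P$ and the variable order $\pi$ (for instance $\pi=\mathrm{id}$, the natural order $x_1,\dots,x_n$), halts after at most $q(S)$ steps, where $S$ is the size of $P$, and decides correctly whether the polynomial computed by $P$ is the zero polynomial. Here an algorithm is a fixed program for a random access machine with memory cells for natural numbers and memory cells for elements of $\mathbb F$. Its constants are natural numbers and $0,1\in\mathbb F$, and each of the following takes one step: reading or writing a cell, adding, subtracting (truncated at $0$) or comparing two natural numbers, an operation $+,-,\times,{}^{-1}$ in $\mathbb F$ (with $0^{-1}=0$), a test for zero in $\mathbb F$. $P$ is given by its number of nodes, $n$, $s$, $t$, $m$, the layer of every node and the (possibly absent) edge label of every pair of nodes; $\pi$ is given by the table of the positions $\pi^{-1}(i)$. -/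

import Mathlib

universe u

namespace StrictIntervalABP

/-! ## Algebraic branching programs -/

/-- Edge labels: elements of `X ∪ F`, where `X = {x_0, …, x_{n-1}}`. -/
inductive EdgeLabel (F : Type u) (n : ℕ) : Type u
  | var (i : Fin n) : EdgeLabel F n
  | const (a : F) : EdgeLabel F n

/-- The polynomial that an edge label stands for. -/
noncomputable def EdgeLabel.toPoly {F : Type u} [Field F] {n : ℕ} :
    EdgeLabel F n → MvPolynomial (Fin n) F
  | .var i => MvPolynomial.X i
  | .const a => MvPolynomial.C a

/-- An algebraic branching program over `F` in `n` variables: a directed acyclic graph, layered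
as `L_0, …, L_depth` with `L_0 = {start}` and `L_depth = {terminal}`, every edge of which goes
from some layer to the next one and carries a label in `X ∪ F`.  `label v w = none` means that
there is no edge from `v` to `w`. -/
structure ABP (F : Type u) (n : ℕ) where
  /-- The number of nodes. -/
  size : ℕ
  /-- The index of the last layer. -/
  depth : ℕ
  /-- The layer that a node lies in. -/
  layer : Fin size → ℕ
  /-- The start node. -/
  start : Fin size
  /-- The terminal node. -/
  terminal : Fin size
  /-- The labelled edges. -/
  label : Fin size → Fin size → Option (EdgeLabel F n)
  layer_le : ∀ v, layer v ≤ depth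
  layer_eq_zero_iff : ∀ v, layer v = 0 ↔ v = start
  layer_eq_depth_iff : ∀ v, layer v = depth ↔ v = terminal
  layer_of_edge : ∀ v w, label v w ≠ none → layer w = layer v + 1

namespace ABP

variable {F : Type u} {n : ℕ} (P : ABP F n)

/-- There is an edge from `v` to `w`. -/
def Edge (v w : Fin P.size) : Prop := P.label v w ≠ none

/-- There is a directed path (possibly of length zero) from `v` to `w`. -/
def Reach (v w : Fin P.size) : Prop := Relation.ReflTransGen P.Edge v w

/-- `p` is a path from the start node to the terminal node.  (Edges join consecutive layers, so
all these paths have exactly `depth` edges.) -/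
def IsPath (p : Fin (P.depth + 1) → Fin P.size) : Prop :=
  p 0 = P.start ∧ p (Fin.last P.depth) = P.terminal ∧
    ∀ k : Fin P.depth, P.Edge (p k.castSucc) (p k.succ)

/-- The polynomial on the edge from `v` to `w` (only used where there is such an edge). -/
noncomputable def edgePoly [Field F] (v w : Fin P.size) : MvPolynomial (Fin n) F :=
  match P.label v w with
  | some l => l.toPoly
  | none => 0

/-- The weight of a path: the product of its edge labels. -/
noncomputable def weight [Field F] (p : Fin (P.depth + 1) → Fin P.size) :
    MvPolynomial (Fin n) F :=
  ∏ k : Fin P.depth, P.edgePoly (p k.castSucc) (p k.succ)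

open Classical in
/-- The polynomial computed by the program: the sum of the weights of all paths from the start
node to the terminal node. -/
noncomputable def poly [Field F] : MvPolynomial (Fin n) F :=
  ∑ p ∈ Finset.univ.filter (fun p : Fin (P.depth + 1) → Fin P.size => P.IsPath p), P.weight p

/-- Every path from the start node to the terminal node reads every variable at most once. -/
def SyntacticMultilinear : Prop :=
  ∀ p, P.IsPath p → ∀ (x : Fin n) (k l : Fin P.depth),
    P.label (p k.castSucc) (p k.succ) = some (.var x) →
    P.label (p l.castSucc) (p l.succ) = some (.var x) → k = l

/-- The set of variables that label an edge of the sub-program with start node `v` and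
terminal node `w`, that is, an edge on some path from `v` to `w`. -/
def vars (v w : Fin P.size) : Set (Fin n) :=
  {x | ∃ a b, P.Reach v a ∧ P.label a b = some (.var x) ∧ P.Reach b w}

end ABP

/-- `I` is a `π`-interval: the set of the variables `x_{π(k)}` with `i ≤ k ≤ j`, for some `i`
and `j` (it is empty if `j < i`). -/
def IsPiInterval {n : ℕ} (π : Equiv.Perm (Fin n)) (I : Set (Fin n)) : Prop :=
  ∃ i j : ℕ, I = {x | ∃ k : Fin n, i ≤ (k : ℕ) ∧ (k : ℕ) ≤ j ∧ x = π k}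

/-- Strict-interval ABPs with respect to the variable order `x_{π(0)}, …, x_{π(n-1)}`. -/
def ABP.IsStrictInterval {F : Type u} {n : ℕ} (P : ABP F n) (π : Equiv.Perm (Fin n)) : Prop :=
  P.SyntacticMultilinear ∧
    ∃ I : Fin P.size → Fin P.size → Set (Fin n),
      (∀ v w, IsPiInterval π (I v w)) ∧
      (∀ v w, P.vars v w ⊆ I v w) ∧
      (∀ v w z, Disjoint (I v w) (I w z))

/-! ## Algorithms over a field

A random access machine with two kinds of memory cells, one kind for natural numbers (indices)
and one for elements of the field.  It is programmed in a small imperative language.  A program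
uses no field constants except `0` and `1`, and one and the same program runs over all fields.
Elementary operations cost one unit each: reading or writing a cell, addition, truncated
subtraction and comparison of indices (but no multiplication), and the arithmetic operations and
the test for zero in the field. -/

/-- The memory: two-dimensional arrays, finitely many of which occur in a given program.
`idx a i j` and `fld a i j` are the entries with indices `i`, `j` of the arrays numbered `a`. -/
structure Memory (F : Type u) where
  /-- Cells that hold natural numbers. -/
  idx : ℕ → ℕ → ℕ → ℕ
  /-- Cells that hold field elements. -/
  fld : ℕ → ℕ → ℕ → F

/-- Write a natural number to a cell. -/
def Memory.setIdx {F : Type u} (m : Memory F) (a i j x : ℕ) : Memory F where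
  idx := fun a' i' j' => if a' = a ∧ i' = i ∧ j' = j then x else m.idx a' i' j'
  fld := m.fld

/-- Write a field element to a cell. -/
def Memory.setFld {F : Type u} (m : Memory F) (a i j : ℕ) (x : F) : Memory F where
  idx := m.idx
  fld := fun a' i' j' => if a' = a ∧ i' = i ∧ j' = j then x else m.fld a' i' j'

/-- Expressions for natural numbers. -/
inductive IdxExpr : Type
  | const (k : ℕ) : IdxExpr
  | read (a : ℕ) (i j : IdxExpr) : IdxExpr
  | add (e f : IdxExpr) : IdxExpr
  | sub (e f : IdxExpr) : IdxExpr

/-- The value of an expression. -/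
def IdxExpr.eval {F : Type u} (m : Memory F) : IdxExpr → ℕ
  | .const k => k
  | .read a i j => m.idx a (i.eval m) (j.eval m)
  | .add e f => e.eval m + f.eval m
  | .sub e f => e.eval m - f.eval m

/-- The number of operations in the evaluation of an expression. -/
def IdxExpr.cost : IdxExpr → ℕ
  | .const _ => 1
  | .read _ i j => i.cost + j.cost + 1
  | .add e f => e.cost + f.cost + 1
  | .sub e f => e.cost + f.cost + 1

/-- Expressions for field elements. -/
inductive FldExpr : Type
  | zero : FldExpr
  | one : FldExpr
  | read (a : ℕ) (i j : IdxExpr) : FldExpr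
  | add (e f : FldExpr) : FldExpr
  | sub (e f : FldExpr) : FldExpr
  | mul (e f : FldExpr) : FldExpr
  | inv (e : FldExpr) : FldExpr

/-- The value of an expression (the inverse of `0` is `0`). -/
def FldExpr.eval {F : Type u} [Field F] (m : Memory F) : FldExpr → F
  | .zero => 0
  | .one => 1
  | .read a i j => m.fld a (i.eval m) (j.eval m)
  | .add e f => e.eval m + f.eval m
  | .sub e f => e.eval m - f.eval m
  | .mul e f => e.eval m * f.eval m
  | .inv e => (e.eval m)⁻¹

/-- The number of operations in the evaluation of an expression. -/
def FldExpr.cost : FldExpr → ℕ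
  | .zero => 1
  | .one => 1
  | .read _ i j => i.cost + j.cost + 1
  | .add e f => e.cost + f.cost + 1
  | .sub e f => e.cost + f.cost + 1
  | .mul e f => e.cost + f.cost + 1
  | .inv e => e.cost + 1

/-- Tests. -/
inductive Test : Type
  | idxEq (e f : IdxExpr) : Test
  | idxLt (e f : IdxExpr) : Test
  | fldZero (e : FldExpr) : Test
  | not (b : Test) : Test
  | and (b c : Test) : Test

/-- The test succeeds. -/
def Test.Holds {F : Type u} [Field F] (m : Memory F) : Test → Prop
  | .idxEq e f => e.eval m = f.eval m
  | .idxLt e f => e.eval m < f.eval m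
  | .fldZero e => e.eval m = 0
  | .not b => ¬ b.Holds m
  | .and b c => b.Holds m ∧ c.Holds m

/-- The number of operations in a test. -/
def Test.cost : Test → ℕ
  | .idxEq e f => e.cost + f.cost + 1
  | .idxLt e f => e.cost + f.cost + 1
  | .fldZero e => e.cost + 1
  | .not b => b.cost + 1
  | .and b c => b.cost + c.cost + 1

/-- Programs. -/
inductive Prog : Type
  | skip : Prog
  | setIdx (a : ℕ) (i j e : IdxExpr) : Prog
  | setFld (a : ℕ) (i j : IdxExpr) (e : FldExpr) : Prog
  | seq (c d : Prog) : Prog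
  | ite (b : Test) (c d : Prog) : Prog
  | while (b : Test) (c : Prog) : Prog

/-- `Runs c m T m'`: the program `c`, started with memory `m`, halts after exactly `T` units of
time with memory `m'`. -/
inductive Runs {F : Type u} [Field F] : Prog → Memory F → ℕ → Memory F → Prop
  | skip (m : Memory F) : Runs .skip m 1 m
  | setIdx (a : ℕ) (i j e : IdxExpr) (m : Memory F) :
      Runs (.setIdx a i j e) m (i.cost + j.cost + e.cost + 1)
        (m.setIdx a (i.eval m) (j.eval m) (e.eval m))
  | setFld (a : ℕ) (i j : IdxExpr) (e : FldExpr) (m : Memory F) :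
      Runs (.setFld a i j e) m (i.cost + j.cost + e.cost + 1)
        (m.setFld a (i.eval m) (j.eval m) (e.eval m))
  | seq {c d : Prog} {m m' m'' : Memory F} {T T' : ℕ} :
      Runs c m T m' → Runs d m' T' m'' → Runs (.seq c d) m (T + T') m''
  | iteTrue {b : Test} {c d : Prog} {m m' : Memory F} {T : ℕ} :
      b.Holds m → Runs c m T m' → Runs (.ite b c d) m (b.cost + T) m'
  | iteFalse {b : Test} {c d : Prog} {m m' : Memory F} {T : ℕ} :
      ¬ b.Holds m → Runs d m T m' → Runs (.ite b c d) m (b.cost + T) m'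
  | whileFalse {b : Test} {c : Prog} {m : Memory F} :
      ¬ b.Holds m → Runs (.while b c) m b.cost m
  | whileTrue {b : Test} {c : Prog} {m m' m'' : Memory F} {T T' : ℕ} :
      b.Holds m → Runs c m T m' → Runs (.while b c) m' T' m'' →
        Runs (.while b c) m (b.cost + T + T') m''

/-! ## Input and output -/

/-- The kind of an edge: `0` for no edge, `1` for a field constant, `2` for a variable. -/
def labelKind {F : Type u} {n : ℕ} : Option (EdgeLabel F n) → ℕ
  | none => 0
  | some (.const _) => 1
  | some (.var _) => 2

/-- The number of the variable on an edge (`0` if the label is not a variable). -/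
def labelVar {F : Type u} {n : ℕ} : Option (EdgeLabel F n) → ℕ
  | some (.var i) => i
  | _ => 0

/-- The field constant on an edge (`0` if the label is not a constant). -/
def labelConst {F : Type u} [Field F] {n : ℕ} : Option (EdgeLabel F n) → F
  | some (.const a) => a
  | _ => 0

/-- The initial memory, which holds the program `P` and the variable order `π`.
Index array `0`: number of nodes, number of variables, start node, terminal node, last layer.
Index array `1`: the layers of the nodes.  Index arrays `2` and `3`, and field array `0`: for
every pair of nodes, the kind of the edge, its variable and its field constant.
Index array `4`: for every variable its position in the order `π`.
All other cells hold zero. -/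
def inputMemory {F : Type u} [Field F] {n : ℕ} (P : ABP F n) (π : Equiv.Perm (Fin n)) :
    Memory F where
  idx := fun a i j =>
    match a with
    | 0 =>
      match i, j with
      | 0, 0 => P.size
      | 0, 1 => n
      | 0, 2 => P.start
      | 0, 3 => P.terminal
      | 0, 4 => P.depth
      | _, _ => 0
    | 1 => if h : i < P.size ∧ j = 0 then P.layer ⟨i, h.1⟩ else 0
    | 2 => if h : i < P.size ∧ j < P.size then labelKind (P.label ⟨i, h.1⟩ ⟨j, h.2⟩) else 0
    | 3 => if h : i < P.size ∧ j < P.size then labelVar (P.label ⟨i, h.1⟩ ⟨j, h.2⟩) else 0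
    | 4 => if h : i < n ∧ j = 0 then (π.symm ⟨i, h.1⟩ : ℕ) else 0
    | _ => 0
  fld := fun a i j =>
    match a with
    | 0 => if h : i < P.size ∧ j < P.size then labelConst (P.label ⟨i, h.1⟩ ⟨j, h.2⟩) else 0
    | _ => 0

/-- The output of a run: the index cell with number `(5, 0, 0)` at the end. -/
def Memory.output {F : Type u} (m : Memory F) : ℕ := m.idx 5 0 0

end StrictIntervalABP

/-! View the program as a weighted automaton over noncommuting variables: `P.coeff w` is the total
weight of the paths that read the word `w`, and a coefficient of the polynomial is the sum of these
values over all orderings of a monomial (`ABP.coeff_poly`). At each node of a path, the letters read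
before and after it lie in disjoint intervals, so every path reads its variables in increasing or in
decreasing order with respect to `π` (`ABP.IsStrictInterval.pairwise`). Only two orderings of a
monomial can matter, an increasing word and its reversal, and they coincide exactly when the word
has at most one letter. So the polynomial is zero iff `P.coeff w.reverse + P.coeff w = 0` for all
`w` and `P.coeff w = 0` for all `w` of length at most one (`ABP.IsStrictInterval.poly_eq_zero_iff`).
The second condition is not redundant in characteristic two.

The sum in the first condition is the weight of `w` in another automaton, the disjoint union of the
program and its reversal (`stateVec_fromBlocks`). Its vanishing is decided by linear algebra: an
echelon basis of the span of the state vectors is grown by multiplying basis vectors by letters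
until it is closed; it never has more vectors than there are states (`spec_extend`, `spec_closure`,
`PartialBasis.vanishes`). Edges with constants read no letter and contribute factors `(1 - C)⁻¹`,
applied by propagation along the acyclic graph (`spec_solve`). The order `π` enters the analysis
only.

Every loop makes at most `2 * P.size` iterations, so a polynomial time bound can be read off the
syntax of the program (`Prog.time`), and `Spec` proves it together with correctness. -/

namespace StrictIntervalABP

/-! ## Memory -/

section Memory

variable {F : Type u}

/-- The natural number in the cell `(a, 0, 0)`. -/
def cell (a : ℕ) : IdxExpr := .read a (.const 0) (.const 0)

/-- Write to the index cell `(a, 0, 0)`. -/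
def assign (a : ℕ) (e : IdxExpr) : Prog := .setIdx a (.const 0) (.const 0) e

/-- The loop `for v = 0, …, e - 1`, with the counter in the cell `(v, 0, 0)`. -/
def forLoop (v : ℕ) (e : IdxExpr) (c : Prog) : Prog :=
  .seq (assign v (.const 0))
    (.while (.idxLt (cell v) e) (.seq c (assign v (.add (cell v) (.const 1)))))

@[simp] theorem eval_cell (m : Memory F) (a : ℕ) : (cell a).eval m = m.idx a 0 0 := rfl

@[simp] theorem setIdx_fld (m : Memory F) (a i j x : ℕ) : (m.setIdx a i j x).fld = m.fld := rfl

@[simp] theorem setFld_idx (m : Memory F) (a i j : ℕ) (x : F) :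
    (m.setFld a i j x).idx = m.idx := rfl

@[simp] theorem setIdx_idx_of_ne (m : Memory F) {a a' : ℕ} (h : a' ≠ a) (i j x : ℕ) :
    (m.setIdx a i j x).idx a' = m.idx a' := by
  funext i' j'
  simp [Memory.setIdx, h]

@[simp] theorem setFld_fld_of_ne (m : Memory F) {a a' : ℕ} (h : a' ≠ a) (i j : ℕ) (x : F) :
    (m.setFld a i j x).fld a' = m.fld a' := by
  funext i' j'
  simp [Memory.setFld, h]

@[simp] theorem setIdx_idx_same (m : Memory F) (a i j x i' j' : ℕ) :
    (m.setIdx a i j x).idx a i' j' = if i' = i ∧ j' = j then x else m.idx a i' j' := by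
  simp [Memory.setIdx]

@[simp] theorem setFld_fld_same (m : Memory F) (a i j : ℕ) (x : F) (i' j' : ℕ) :
    (m.setFld a i j x).fld a i' j' = if i' = i ∧ j' = j then x else m.fld a i' j' := by
  simp [Memory.setFld]

/-- The index arrays outside `A` and the field arrays outside `B` are the same. -/
def Frame (A B : List ℕ) (m m' : Memory F) : Prop :=
  (∀ a, a ∉ A → m'.idx a = m.idx a) ∧ ∀ a, a ∉ B → m'.fld a = m.fld a

theorem Frame.refl (A B : List ℕ) (m : Memory F) : Frame A B m m :=
  ⟨fun _ _ => rfl, fun _ _ => rfl⟩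

/-- The array numbers are concrete, so `decide` absorbs the footprint of a subroutine into that of
its caller. -/
theorem Frame.trans {A B A' B' : List ℕ} {m m' m'' : Memory F} (h : Frame A B m m')
    (h' : Frame A' B' m' m'') (hA : A' ⊆ A := by decide) (hB : B' ⊆ B := by decide) :
    Frame A B m m'' :=
  ⟨fun a ha => (h'.1 a fun h => ha (hA h)).trans (h.1 a ha),
    fun a ha => (h'.2 a fun h => ha (hB h)).trans (h.2 a ha)⟩

theorem Frame.mono {A B A' B' : List ℕ} {m m' : Memory F} (h : Frame A' B' m m')
    (hA : A' ⊆ A := by decide) (hB : B' ⊆ B := by decide) : Frame A B m m' :=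
  (Frame.refl A B m).trans h hA hB

theorem Frame.setIdx {A B : List ℕ} {m m' : Memory F} (h : Frame A B m m') {a : ℕ} (i j x : ℕ)
    (ha : a ∈ A := by decide) : Frame A B m (m'.setIdx a i j x) :=
  ⟨fun b hb => by rw [setIdx_idx_of_ne _ (by rintro rfl; exact hb ha), h.1 b hb], h.2⟩

theorem Frame.setFld {A B : List ℕ} {m m' : Memory F} (h : Frame A B m m') {a : ℕ} (i j : ℕ)
    (x : F) (ha : a ∈ B := by decide) : Frame A B m (m'.setFld a i j x) :=
  ⟨h.1, fun b hb => by rw [setFld_fld_of_ne _ (by rintro rfl; exact hb ha), h.2 b hb]⟩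

theorem Frame.idx {A B : List ℕ} {m m' : Memory F} (h : Frame A B m m') (a : ℕ)
    (ha : a ∉ A := by decide) : m'.idx a = m.idx a := h.1 a ha

theorem Frame.fld {A B : List ℕ} {m m' : Memory F} (h : Frame A B m m') (a : ℕ)
    (ha : a ∉ B := by decide) : m'.fld a = m.fld a := h.2 a ha

end Memory

/-! ## Total correctness with a syntactic time bound -/

/-- A bound on the running time of a program all of whose loops make at most `X` iterations. -/
noncomputable def Prog.time : Prog → Polynomial ℕ
  | .skip => 1
  | .setIdx _ i j e => Polynomial.C (i.cost + j.cost + e.cost + 1)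
  | .setFld _ i j e => Polynomial.C (i.cost + j.cost + e.cost + 1)
  | .seq c d => c.time + d.time
  | .ite b c d => Polynomial.C b.cost + (c.time + d.time)
  | .while b c => Polynomial.X * (Polynomial.C b.cost + c.time) + Polynomial.C b.cost

section Framework

variable {F : Type u} [Field F]

/-- The program `c`, started with memory `m`, halts within the time bound for loops of at most `N`
iterations, with a memory that satisfies `Q`. -/
def Spec (N : ℕ) (c : Prog) (m : Memory F) (Q : Memory F → Prop) : Prop :=
  ∃ T m', Runs c m T m' ∧ T ≤ c.time.eval N ∧ Q m'

theorem Spec.mono {N : ℕ} {c : Prog} {m : Memory F} {Q Q' : Memory F → Prop}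
    (h : Spec N c m Q) (hQ : ∀ m', Q m' → Q' m') : Spec N c m Q' := by
  obtain ⟨T, m', hr, ht, hq⟩ := h
  exact ⟨T, m', hr, ht, hQ _ hq⟩

theorem Spec.skip {N : ℕ} {m : Memory F} {Q : Memory F → Prop} (h : Q m) :
    Spec N .skip m Q :=
  ⟨_, _, .skip m, by simp [Prog.time], h⟩

theorem Spec.setIdx {N a : ℕ} {i j e : IdxExpr} {m : Memory F} {Q : Memory F → Prop}
    (h : Q (m.setIdx a (i.eval m) (j.eval m) (e.eval m))) : Spec N (.setIdx a i j e) m Q :=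
  ⟨_, _, .setIdx a i j e m, by simp [Prog.time], h⟩

theorem Spec.setFld {N a : ℕ} {i j : IdxExpr} {e : FldExpr} {m : Memory F} {Q : Memory F → Prop}
    (h : Q (m.setFld a (i.eval m) (j.eval m) (e.eval m))) : Spec N (.setFld a i j e) m Q :=
  ⟨_, _, .setFld a i j e m, by simp [Prog.time], h⟩

theorem Spec.seq {N : ℕ} {c d : Prog} {m : Memory F} {Q : Memory F → Prop}
    (h : Spec N c m (fun m' => Spec N d m' Q)) : Spec N (.seq c d) m Q := by
  obtain ⟨T, m', hr, ht, T', m'', hr', ht', hq⟩ := h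
  refine ⟨_, _, .seq hr hr', ?_, hq⟩
  simp only [Prog.time, Polynomial.eval_add]
  omega

theorem Spec.ite {N : ℕ} {b : Test} {c d : Prog} {m : Memory F} {Q : Memory F → Prop}
    (hc : b.Holds m → Spec N c m Q) (hd : ¬ b.Holds m → Spec N d m Q) :
    Spec N (.ite b c d) m Q := by
  by_cases hb : b.Holds m
  · obtain ⟨T, m', hr, ht, hq⟩ := hc hb
    refine ⟨_, _, .iteTrue hb hr, ?_, hq⟩
    simp only [Prog.time, Polynomial.eval_add, Polynomial.eval_C]
    omega
  · obtain ⟨T, m', hr, ht, hq⟩ := hd hb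
    refine ⟨_, _, .iteFalse hb hr, ?_, hq⟩
    simp only [Prog.time, Polynomial.eval_add, Polynomial.eval_C]
    omega

/-- The invariant counts the iterations, so one induction gives termination, the time bound and
correctness. -/
theorem Spec.while {N n : ℕ} (hn : n ≤ N) {b : Test} {c : Prog} {m : Memory F}
    (I : ℕ → Memory F → Prop) (h0 : I 0 m)
    (hstep : ∀ i < n, ∀ m', I i m' → b.Holds m' ∧ Spec N c m' (I (i + 1)))
    (hend : ∀ m', I n m' → ¬ b.Holds m') :
    Spec N (.while b c) m (I n) := by
  have key : ∀ k i, i + k = n → ∀ m', I i m' → ∃ T m'', Runs (.while b c) m' T m'' ∧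
      T ≤ k * (b.cost + c.time.eval N) + b.cost ∧ I n m'' := by
    intro k
    induction k with
    | zero =>
      intro i hi m' hm'
      obtain rfl : i = n := by omega
      exact ⟨_, _, .whileFalse (hend _ hm'), by simp, hm'⟩
    | succ k ih =>
      intro i hi m' hm'
      obtain ⟨hb, T, m₁, hr, ht, h₁⟩ := hstep i (by omega) m' hm'
      obtain ⟨T', m₂, hr', ht', h₂⟩ := ih (i + 1) (by omega) m₁ h₁
      refine ⟨_, _, .whileTrue hb hr hr', ?_, h₂⟩
      rw [Nat.succ_mul]
      omega
  obtain ⟨T, m', hr, ht, hq⟩ := key n 0 (by omega) m h0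
  refine ⟨T, m', hr, ht.trans ?_, hq⟩
  simp only [Prog.time, Polynomial.eval_add, Polynomial.eval_mul, Polynomial.eval_X,
    Polynomial.eval_C]
  gcongr

theorem Spec.assign {N a : ℕ} {e : IdxExpr} {m : Memory F} {Q : Memory F → Prop}
    (h : Q (m.setIdx a 0 0 (e.eval m))) : Spec N (assign a e) m Q :=
  Spec.setIdx h

/-- The bound `e` is evaluated again before each iteration, so the invariant has to determine its
value. -/
theorem Spec.forLoop {N n v : ℕ} (hn : n ≤ N) {e : IdxExpr} {c : Prog} {m : Memory F}
    (I : ℕ → Memory F → Prop) (h0 : I 0 (m.setIdx v 0 0 0))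
    (he : ∀ i m', I i m' → e.eval m' = n)
    (hstep : ∀ i < n, ∀ m', I i m' → m'.idx v 0 0 = i →
      Spec N c m' (fun m'' => m''.idx v 0 0 = i ∧ I (i + 1) (m''.setIdx v 0 0 (i + 1)))) :
    Spec N (forLoop v e c) m (I n) := by
  refine Spec.seq (Spec.assign (Spec.mono
    (Spec.while hn (fun i m' => I i m' ∧ m'.idx v 0 0 = i) ⟨h0, by simp [IdxExpr.eval]⟩ ?_ ?_)
    fun m' h => h.1))
  · rintro i hi m' ⟨hI, hv⟩
    refine ⟨?_, Spec.seq ((hstep i hi m' hI hv).mono ?_)⟩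
    · simp only [Test.Holds, eval_cell, hv, he i m' hI, hi]
    · rintro m'' ⟨hv', hI'⟩
      refine Spec.assign ?_
      simp only [IdxExpr.eval, eval_cell, hv']
      exact ⟨hI', by simp⟩
  · rintro m' ⟨hI, hv⟩
    simp [Test.Holds, hv, he n m' hI]

end Framework

/-! ## Acyclic linear systems -/

section Acyclic

open Matrix

variable {F : Type u} [Field F] {V : Type*} [Fintype V]

/-- The new rank of a node is the number of nodes of smaller rank. `solve` makes one round per node,
while layer numbers may exceed the number of nodes, since layers can be empty. -/
theorem exists_rank_lt_card {C : Matrix V V F} {rk : V → ℕ}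
    (h : ∀ u v, C u v ≠ 0 → rk u < rk v) :
    ∃ rk' : V → ℕ, (∀ u v, C u v ≠ 0 → rk' u < rk' v) ∧ ∀ v, rk' v < Fintype.card V := by
  refine ⟨fun v => (Finset.univ.filter fun u => rk u < rk v).card, fun u v huv => ?_, fun v => ?_⟩
  · refine Finset.card_lt_card (Finset.ssubset_iff_of_subset ?_ |>.2 ⟨u, ?_, ?_⟩)
    · intro w hw
      simp only [Finset.mem_filter, Finset.mem_univ, true_and] at hw ⊢
      exact hw.trans (h u v huv)
    · simpa using h u v huv
    · simp
  · refine Finset.card_lt_univ_of_notMem (x := v) ?_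
    simp

variable [DecidableEq V]

/-- A nonzero entry of `C ^ k` raises the rank by at least `k`, so `C` is nilpotent. -/
theorem isUnit_one_sub_of_rank {C : Matrix V V F} {rk : V → ℕ}
    (h : ∀ u v, C u v ≠ 0 → rk u < rk v) : IsUnit (1 - C) := by
  have key : ∀ k u v, (C ^ k) u v ≠ 0 → rk u + k ≤ rk v := by
    intro k
    induction k with
    | zero =>
      intro u v huv
      obtain rfl : u = v := by
        by_contra hne
        exact huv (by simp [hne])
      simp
    | succ k ih =>
      intro u v huv
      rw [pow_succ, Matrix.mul_apply] at huv
      obtain ⟨j, -, hj⟩ := Finset.exists_ne_zero_of_sum_ne_zero huv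
      have h1 := ih u j (left_ne_zero_of_mul hj)
      have h2 := h j v (right_ne_zero_of_mul hj)
      omega
  refine IsNilpotent.isUnit_one_sub ⟨Finset.univ.sup rk + 1, ?_⟩
  ext u v
  by_contra hne
  have h1 := key _ u v hne
  have h2 : rk v ≤ Finset.univ.sup rk := Finset.le_sup (Finset.mem_univ v)
  omega

theorem vecMul_inv_one_sub {C : Matrix V V F} (h : IsUnit (1 - C)) (z : V → F) :
    z ᵥ* (1 - C)⁻¹ = z + (z ᵥ* (1 - C)⁻¹) ᵥ* C := by
  have hd : IsUnit (1 - C).det := (Matrix.isUnit_iff_isUnit_det _).1 h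
  have : (z ᵥ* (1 - C)⁻¹) ᵥ* (1 - C) = z := by
    rw [Matrix.vecMul_vecMul, Matrix.nonsing_inv_mul _ hd, Matrix.vecMul_one]
  rw [Matrix.vecMul_sub, Matrix.vecMul_one] at this
  exact sub_eq_iff_eq_add.1 this

end Acyclic

/-! ## The program -/

/-- The field element in the cell `(a, 0, 0)`. -/
def fcell (a : ℕ) : FldExpr := .read a (.const 0) (.const 0)

/-- The entry of the field array `a` whose indices are in the index cells `v` and `w`. -/
def entry (a v w : ℕ) : FldExpr := .read a (cell v) (cell w)

/-- The entry of the field vector `a` whose index is in the index cell `v`. -/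
def ventry (a v : ℕ) : FldExpr := .read a (cell v) (.const 0)

/-- With `v` in cell `14`: `y v := z v + ∑ u, y u * C u v`. -/
def relax : Prog :=
  .seq (.setFld 4 (.const 0) (.const 0) (ventry 5 14))
    (.seq (forLoop 15 (cell 6)
        (.setFld 4 (.const 0) (.const 0) (.add (fcell 4) (.mul (ventry 2 15) (entry 1 15 14)))))
      (.setFld 2 (cell 14) (.const 0) (fcell 4)))

/-- Solve `y = z + y * C` for acyclic `C`. -/
def solve : Prog := forLoop 16 (cell 6) (forLoop 14 (cell 6) relax)

/-- With `k` and `x` in the cells `11` and `17`: let `z` be the product of row `k` of the basis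
with the matrix of the edges labelled by the variable `x`. -/
def readLetter : Prog :=
  forLoop 14 (cell 6)
    (.seq (.setFld 5 (cell 14) (.const 0) .zero)
      (forLoop 15 (cell 6)
        (.ite (.and (.idxEq (.read 7 (cell 15) (cell 14)) (.const 2))
            (.idxEq (.read 8 (cell 15) (cell 14)) (cell 17)))
          (.setFld 5 (cell 14) (.const 0) (.add (ventry 5 14) (entry 3 11 15)))
          .skip)))

/-- Reduce `y` modulo the basis. -/
def reduce : Prog :=
  forLoop 21 (cell 10)
    (.seq (.setFld 4 (.const 0) (.const 0) (.read 2 (.read 9 (cell 21) (.const 0)) (.const 0)))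
      (forLoop 14 (cell 6)
        (.setFld 2 (cell 14) (.const 0)
          (.sub (ventry 2 14) (.mul (fcell 4) (entry 3 21 14))))))

/-- Let cell `18` be an index where `y` is not zero, if there is one. -/
def findPivot : Prog :=
  .seq (assign 18 (cell 6))
    (forLoop 14 (cell 6) (.ite (.fldZero (ventry 2 14)) .skip (assign 18 (cell 14))))

/-- Scale `y` to have the entry `1` at the index in cell `18`, and append it to the basis. -/
def push : Prog :=
  .seq (.setFld 4 (.const 0) (.const 0) (.inv (ventry 2 18)))
    (.seq (forLoop 14 (cell 6)
        (.setFld 3 (cell 10) (cell 14) (.mul (ventry 2 14) (fcell 4))))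
      (.seq (.setIdx 9 (cell 10) (.const 0) (cell 18))
        (assign 10 (.add (cell 10) (.const 1)))))

/-- Set the output to `0` if `y` is not accepted. -/
def checkSum : Prog :=
  .ite (.fldZero (.add (ventry 2 19) (ventry 2 20))) .skip (assign 5 (.const 0))

/-- Set the output to `0` if `y` is not accepted as the vector of a short word. -/
def checkShort : Prog :=
  .ite (.fldZero (ventry 2 19)) .skip (assign 5 (.const 0))

/-- Set the output to `0` if `y` is not accepted; the test for short words is only made if cell
`11` is zero. -/
def check : Prog := .seq checkSum (.ite (.idxEq (cell 11) (.const 0)) checkShort .skip)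

/-- Multiply row `k` of the basis by a letter, test the result and add it to the basis. -/
def extend : Prog :=
  .seq readLetter (.seq solve (.seq check
    (.seq reduce (.seq findPivot (.ite (.idxLt (cell 18) (cell 6)) push .skip)))))

/-- Close the basis under multiplication by letters. -/
def closure : Prog :=
  forLoop 11 (cell 6)
    (.ite (.idxLt (cell 11) (cell 10))
      (forLoop 12 (cell 6) (forLoop 13 (cell 6)
        (.seq (assign 17 (.read 8 (cell 12) (cell 13))) extend)))
      .skip)

/-- Let the basis consist of `y`, whose entry at the index `s` is `1`. -/
def initBasis : Prog :=
  .seq (forLoop 14 (cell 6) (.setFld 3 (.const 0) (cell 14) (ventry 2 14)))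
    (.seq (.setIdx 9 (.const 0) (.const 0) (.read 0 (.const 0) (.const 2)))
      (assign 10 (.const 1)))

/-- The test for zero of the weighted automaton in memory, with initial vector `z`. -/
def zeroTest : Prog :=
  .seq solve (.seq initBasis (.seq (assign 5 (.const 1)) (.seq (assign 11 (.const 0))
    (.seq check closure))))

/-! ## Verification of the linear algebra -/

section LinearAlgebra

open Matrix

variable {F : Type u} [Field F]

/-- The first `N` entries of the field vector `a`. -/
def vec (N : ℕ) (m : Memory F) (a : ℕ) : Fin N → F := fun v => m.fld a v 0

/-- The matrix of the edges that carry a constant. -/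
def constMatrix (N : ℕ) (m : Memory F) : Matrix (Fin N) (Fin N) F :=
  .of fun u v => m.fld 1 u v

/-- The matrix of the edges that carry the variable `x`. -/
def varMatrix (N : ℕ) (m : Memory F) (x : ℕ) : Matrix (Fin N) (Fin N) F :=
  .of fun u v => if m.idx 7 u v = 2 ∧ m.idx 8 u v = x then 1 else 0

/-- Row `k` of the basis. -/
def row (N : ℕ) (m : Memory F) (k : ℕ) : Fin N → F := fun v => m.fld 3 k v

theorem spec_relax {N : ℕ} {m : Memory F} (hN : m.idx 6 0 0 = N) {v : Fin N}
    (hv : m.idx 14 0 0 = v) :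
    Spec N relax m (fun m' => Frame [15] [2, 4] m m' ∧
      vec N m' 2 = Function.update (vec N m 2) v
        (vec N m 5 v + ∑ u, vec N m 2 u * constMatrix N m u v)) := by
  refine Spec.seq (Spec.setFld (Spec.seq ((Spec.forLoop le_rfl
    (fun i m' => Frame [15] [4] m m' ∧
      m'.fld 4 0 0 = m.fld 5 v 0 + ∑ u ∈ Finset.range i, m.fld 2 u 0 * m.fld 1 u v)
      ?_ ?_ ?_).mono ?_)))
  · refine ⟨((Frame.refl _ _ _).setFld _ _ _).setIdx _ _ _, ?_⟩
    simp [ventry, FldExpr.eval, IdxExpr.eval, hv]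
  · rintro i m' ⟨hF, -⟩
    rw [eval_cell, hF.idx 6, hN]
  · rintro i hi m' ⟨hF, hs⟩ hc
    refine Spec.setFld ⟨by simpa using hc, (hF.setFld _ _ _).setIdx _ _ _, ?_⟩
    rw [Finset.sum_range_succ, ← add_assoc, ← hs]
    simp [ventry, entry, fcell, FldExpr.eval, IdxExpr.eval, hF.idx 14, hF.fld 2, hF.fld 1, hc, hv]
  · rintro m' ⟨hF, hs⟩
    refine Spec.setFld ⟨hF.mono.setFld _ _ _, ?_⟩
    funext w
    simp only [vec, Function.update_apply, constMatrix, Matrix.of_apply, eval_cell, hF.idx 14, hv,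
      setFld_fld_same, fcell, FldExpr.eval, IdxExpr.eval, hs, hF.fld 2, and_true, Fin.val_inj]
    rw [Finset.sum_range fun u => m.fld 2 u 0 * m.fld 1 u v]

/-- An entry of rank `r` depends only on entries of smaller rank, so it is right after round `r + 1`
and stays right, whatever `y` contained at the start. -/
theorem spec_solve {N : ℕ} {m : Memory F} (hN : m.idx 6 0 0 = N) {rk : Fin N → ℕ}
    (hrk : ∀ u v, constMatrix N m u v ≠ 0 → rk u < rk v) :
    Spec N solve m (fun m' => Frame [14, 15, 16] [2, 4] m m' ∧
      vec N m' 2 = vec N m 5 ᵥ* (1 - constMatrix N m)⁻¹) := by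
  have hfix := vecMul_inv_one_sub (isUnit_one_sub_of_rank hrk) (vec N m 5)
  set s := vec N m 5 ᵥ* (1 - constMatrix N m)⁻¹ with hs
  obtain ⟨rk, hrk, hlt⟩ := exists_rank_lt_card hrk
  rw [Fintype.card_fin] at hlt
  refine (Spec.forLoop le_rfl
    (fun q m' => Frame [14, 15, 16] [2, 4] m m' ∧ ∀ v, rk v < q → vec N m' 2 v = s v)
    ⟨(Frame.refl _ _ _).setIdx _ _ _, by simp⟩ ?_ ?_).mono
      fun m' h => ⟨h.1, funext fun v => h.2 v (hlt v)⟩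
  · rintro i m' ⟨hF, -⟩
    rw [eval_cell, hF.idx 6, hN]
  rintro q - m' ⟨hF, hq⟩ hc
  -- Within a round, entries of rank below `q` stay right and those of rank `q` become right once
  -- visited.
  refine (Spec.forLoop le_rfl
    (fun i m'' => Frame [14, 15] [2, 4] m' m'' ∧ (∀ v, rk v < q → vec N m'' 2 v = s v) ∧
      ∀ v : Fin N, v < i → rk v < q + 1 → vec N m'' 2 v = s v)
    ⟨(Frame.refl _ _ _).setIdx _ _ _, hq, by simp⟩ ?_ ?_).mono ?_
  · rintro i m'' ⟨hF', -⟩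
    rw [eval_cell, hF'.idx 6, hF.idx 6, hN]
  · rintro i hi m'' ⟨hF', hlt', hle⟩ hc'
    have hF'' : Frame [14, 15, 16] [2, 4] m m'' := hF.trans hF'
    have hN'' : m''.idx 6 0 0 = N := by rw [hF''.idx 6, hN]
    refine (spec_relax hN'' (v := ⟨i, hi⟩) hc').mono ?_
    rintro m₃ ⟨hF₃, hy⟩
    have h5 : vec N m'' 5 = vec N m 5 := by unfold vec; rw [hF''.fld 5]
    have hC : constMatrix N m'' = constMatrix N m := by simp only [constMatrix, hF''.fld 1]
    have hnew : rk ⟨i, hi⟩ < q + 1 → vec N m₃ 2 ⟨i, hi⟩ = s ⟨i, hi⟩ := by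
      intro hr
      rw [hy, Function.update_self, h5, hC, hfix, Pi.add_apply, Matrix.vecMul, dotProduct]
      congr 1
      refine Finset.sum_congr rfl fun u _ => ?_
      by_cases hu : constMatrix N m u ⟨i, hi⟩ = 0
      · simp [hu]
      · rw [hlt' u (by have := hrk _ _ hu; omega)]
    have hold : ∀ v, v ≠ ⟨i, hi⟩ → vec N m₃ 2 v = vec N m'' 2 v := fun v hv => by
      rw [hy, Function.update_of_ne hv]
    refine ⟨by rw [hF₃.idx 14, hc'], (hF'.trans hF₃).setIdx _ _ _, fun v hv => ?_,
      fun v hvi hv => ?_⟩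
    · change vec N m₃ 2 v = s v
      by_cases hvi : v = ⟨i, hi⟩
      · subst hvi
        exact hnew (by omega)
      · rw [hold v hvi, hlt' v hv]
    · change vec N m₃ 2 v = s v
      by_cases hvi' : v = ⟨i, hi⟩
      · subst hvi'
        exact hnew hv
      · rw [hold v hvi']
        exact hle v (by have : (v : ℕ) ≠ i := fun h => hvi' (Fin.ext h); omega) hv
  · rintro m'' ⟨hF', -, hle⟩
    exact ⟨by rw [hF'.idx 16, hc], (hF.trans hF').setIdx _ _ _, fun v hv => hle v v.2 hv⟩

theorem spec_readLetter {N : ℕ} {m : Memory F} (hN : m.idx 6 0 0 = N) :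
    Spec N readLetter m (fun m' => Frame [14, 15] [5] m m' ∧
      vec N m' 5 = row N m (m.idx 11 0 0) ᵥ* varMatrix N m (m.idx 17 0 0)) := by
  set k := m.idx 11 0 0 with hk
  set x := m.idx 17 0 0 with hx
  refine (Spec.forLoop le_rfl
    (fun i m' => Frame [14, 15] [5] m m' ∧ ∀ v : Fin N, v < i →
      vec N m' 5 v = (row N m k ᵥ* varMatrix N m x) v)
    ⟨(Frame.refl _ _ _).setIdx _ _ _, by simp⟩ ?_ ?_).mono
      fun m' h => ⟨h.1, funext fun v => h.2 v v.2⟩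
  · rintro i m' ⟨hF, -⟩
    rw [eval_cell, hF.idx 6, hN]
  rintro i hi m' ⟨hF, hv⟩ hc
  refine Spec.seq (Spec.setFld ((Spec.forLoop le_rfl
    (fun j m'' => Frame [15] [5] m' m'' ∧ (∀ v ≠ i, m''.fld 5 v 0 = m'.fld 5 v 0) ∧
      m''.fld 5 i 0 = ∑ u ∈ Finset.range j,
        m.fld 3 k u * if m.idx 7 u i = 2 ∧ m.idx 8 u i = x then 1 else 0)
    ⟨((Frame.refl _ _ _).setFld _ _ _).setIdx _ _ _, ?_, ?_⟩ ?_ ?_).mono ?_))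
  · intro v hvi
    simp [hc, hvi]
  · simp [hc, FldExpr.eval, IdxExpr.eval]
  · rintro j m'' ⟨hF', -⟩
    rw [eval_cell, hF'.idx 6, hF.idx 6, hN]
  · rintro j hj m'' ⟨hF', hne, hs⟩ hc'
    have hF'' : Frame [14, 15] [5] m m'' := hF.trans hF'
    have hb : (Test.and (.idxEq (.read 7 (cell 15) (cell 14)) (.const 2))
        (.idxEq (.read 8 (cell 15) (cell 14)) (cell 17))).Holds m'' ↔
        m.idx 7 j i = 2 ∧ m.idx 8 j i = x := by
      simp [Test.Holds, IdxExpr.eval, hc', hF'.idx 14, hc, hF''.idx 7, hF''.idx 8, hF''.idx 17, hx]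
    refine Spec.ite (fun h => Spec.setFld ?_) (fun h => Spec.skip ?_)
    · refine ⟨by simpa using hc', (hF'.setFld _ _ _).setIdx _ _ _, fun v hvi => ?_, ?_⟩
      · simp [hF'.idx 14, hc, hvi, hne]
      · rw [Finset.sum_range_succ, ← hs, if_pos (hb.1 h)]
        simp [hF'.idx 14, hc, ventry, entry, FldExpr.eval, IdxExpr.eval, hF''.fld 3, hF''.idx 11,
          hc', hk]
    · refine ⟨hc', hF'.setIdx _ _ _, hne, ?_⟩
      rw [Finset.sum_range_succ, ← hs, if_neg (hb.not.1 h), mul_zero, add_zero, setIdx_fld]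
  · rintro m'' ⟨hF', hne, hs⟩
    refine ⟨by rw [hF'.idx 14, hc], (hF.trans hF').setIdx _ _ _, fun v hvi => ?_⟩
    by_cases h : (v : ℕ) = i
    · subst h
      simp only [vec, setIdx_fld, hs, Matrix.vecMul, dotProduct, row, varMatrix, Matrix.of_apply]
      rw [Finset.sum_range fun u =>
        m.fld 3 k u * if m.idx 7 u v = 2 ∧ m.idx 8 u v = x then 1 else 0]
    · rw [← hv v (by omega)]
      exact hne v h

/-- The value `N` is a sentinel for the zero vector. -/
theorem spec_findPivot {N : ℕ} {m : Memory F} (hN : m.idx 6 0 0 = N) :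
    Spec N findPivot m (fun m' => Frame [14, 18] [] m m' ∧
      ((m'.idx 18 0 0 = N ∧ vec N m 2 = 0) ∨
        ∃ v : Fin N, m'.idx 18 0 0 = v ∧ vec N m 2 v ≠ 0)) := by
  refine Spec.seq (Spec.assign ((Spec.forLoop le_rfl
    (fun i m' => Frame [14, 18] [] m m' ∧
      ((m'.idx 18 0 0 = N ∧ ∀ v : Fin N, v < i → vec N m 2 v = 0) ∨
        ∃ v : Fin N, m'.idx 18 0 0 = v ∧ vec N m 2 v ≠ 0))
    ⟨((Frame.refl _ _ _).setIdx _ _ _).setIdx _ _ _, Or.inl ?_⟩ ?_ ?_).mono ?_))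
  · simp [hN]
  · rintro i m' ⟨hF, -⟩
    rw [eval_cell, hF.idx 6, hN]
  · rintro i hi m' ⟨hF, h⟩ hc
    have hy : (ventry 2 14).eval m' = vec N m 2 ⟨i, hi⟩ := by
      simp [ventry, FldExpr.eval, IdxExpr.eval, hc, vec, hF.fld 2]
    refine Spec.ite (fun hb => Spec.skip ⟨hc, hF.setIdx _ _ _, ?_⟩)
      (fun hb => Spec.assign ⟨by simpa using hc, (hF.setIdx _ _ _).setIdx _ _ _,
        Or.inr ⟨⟨i, hi⟩, ?_, ?_⟩⟩)
    · rw [setIdx_idx_of_ne _ (by decide)]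
      refine h.imp_left fun h => ⟨h.1, fun v hv => ?_⟩
      rcases Nat.lt_succ_iff_lt_or_eq.1 hv with hv | hv
      · exact h.2 v hv
      · obtain rfl : v = ⟨i, hi⟩ := Fin.ext hv
        rw [← hy]
        exact hb
    · simp [hc]
    · rw [← hy]
      exact hb
  · rintro m' ⟨hF, h⟩
    exact ⟨hF, h.imp_left fun h => ⟨h.1, funext fun v => h.2 v v.2⟩⟩

theorem spec_push {N : ℕ} {m : Memory F} (hN : m.idx 6 0 0 = N) {p : ℕ}
    (hp : m.idx 18 0 0 = p) {r : ℕ} (hr : m.idx 10 0 0 = r) :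
    Spec N push m (fun m' => Frame [9, 10, 14] [3, 4] m m' ∧ m'.idx 10 0 0 = r + 1 ∧
      m'.idx 9 r 0 = p ∧ (∀ l ≠ r, m'.idx 9 l 0 = m.idx 9 l 0) ∧
      row N m' r = (m.fld 2 p 0)⁻¹ • vec N m 2 ∧ ∀ l ≠ r, row N m' l = row N m l) := by
  refine Spec.seq (Spec.setFld (Spec.seq ((Spec.forLoop le_rfl
    (fun i m' => Frame [14] [3, 4] m m' ∧ m'.fld 4 0 0 = (m.fld 2 p 0)⁻¹ ∧
      (∀ v : Fin N, v < i → row N m' r v = (m.fld 2 p 0)⁻¹ * vec N m 2 v) ∧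
      ∀ l ≠ r, row N m' l = row N m l)
    ⟨((Frame.refl _ _ _).setFld _ _ _).setIdx _ _ _, ?_, ?_, ?_⟩ ?_ ?_).mono ?_)))
  · simp [ventry, FldExpr.eval, IdxExpr.eval, hp]
  · simp
  · intro l _
    unfold row
    simp
  · rintro i m' ⟨hF, -⟩
    rw [eval_cell, hF.idx 6, hN]
  · rintro i hi m' ⟨hF, ht, hlt, hne⟩ hc
    refine Spec.setFld ⟨by simpa using hc, (hF.setFld _ _ _).setIdx _ _ _, by simpa using ht,
      fun v hv => ?_, fun l hl => ?_⟩
    · simp only [row, setIdx_fld, eval_cell, setFld_fld_same, hc, hF.idx 10, hr, true_and]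
      by_cases h : (v : ℕ) = i
      · rw [if_pos h, mul_comm]
        simp [FldExpr.eval, ventry, fcell, IdxExpr.eval, vec, hF.fld 2, ht, hc, h]
      · rw [if_neg h]
        exact hlt v (by omega)
    · rw [← hne l hl]
      funext v
      simp [row, hF.idx 10, hr, hl]
  · rintro m' ⟨hF, -, hlt, hne⟩
    refine Spec.seq (Spec.setIdx (Spec.assign
      ⟨(hF.mono.setIdx _ _ _).setIdx _ _ _, ?_, ?_, ?_, ?_, ?_⟩))
    · simp [IdxExpr.eval, hF.idx 10, hr]
    · simp [IdxExpr.eval, hF.idx 10, hr, hF.idx 18, hp]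
    · intro l hl
      simp [IdxExpr.eval, hF.idx 10, hr, hl, hF.idx 9]
    · funext v
      exact hlt v v.2
    · exact hne

end LinearAlgebra

/-! ## Verification of the zero test for weighted automata -/

section Congr

variable {F : Type u} {N : ℕ} {m m' : Memory F}

theorem row_congr (h : m'.fld 3 = m.fld 3) : row N m' = row N m := by
  unfold row
  rw [h]

theorem vec_congr {a : ℕ} (h : m'.fld a = m.fld a) : vec N m' a = vec N m a := by
  unfold vec
  rw [h]

theorem vec_setIdx (a i j x b : ℕ) : vec N (m.setIdx a i j x) b = vec N m b := rfl

/-- From `m` to `m'`, the basis has at most been extended, and the output has not become `1`. -/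
structure Grows (N : ℕ) (m m' : Memory F) : Prop where
  le : m.idx 10 0 0 ≤ m'.idx 10 0 0
  row : ∀ l < m.idx 10 0 0, row N m' l = row N m l
  output : m'.idx 5 0 0 = 1 → m.idx 5 0 0 = 1

theorem Grows.of_eq (h5 : m'.idx 5 = m.idx 5) (h10 : m'.idx 10 = m.idx 10)
    (h3 : m'.fld 3 = m.fld 3) : Grows N m m' :=
  ⟨by rw [h10], fun _ _ => by rw [row_congr h3], by rw [h5]; exact id⟩

end Congr

section ZeroTest

open Matrix

variable {F : Type u} [Field F] {N : ℕ}

/-- The action of the letter `x` on the state vectors of a weighted automaton. -/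
noncomputable def letterMap {V : Type*} [Fintype V] [DecidableEq V] (C : Matrix V V F)
    (M : ℕ → Matrix V V F) (x : ℕ) : (V → F) →ₗ[F] (V → F) :=
  Matrix.vecMulLinear (M x * (1 - C)⁻¹)

/-- The state vector after reading a word from right to left. -/
noncomputable def stateVec {V : Type*} [Fintype V] [DecidableEq V] (C : Matrix V V F)
    (M : ℕ → Matrix V V F) (z : V → F) : List ℕ → (V → F)
  | [] => z ᵥ* (1 - C)⁻¹
  | x :: w => letterMap C M x (stateVec C M z w)

/-- The weights of all words vanish, where `p` and `q` are the accepting states, and those of the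
words of length at most one vanish even if only `p` is accepting. -/
def Vanishes {V : Type*} [Fintype V] [DecidableEq V] (C : Matrix V V F) (M : ℕ → Matrix V V F)
    (z : V → F) (p q : V) : Prop :=
  (∀ w, stateVec C M z w p + stateVec C M z w q = 0) ∧
    ∀ w, w.length ≤ 1 → stateVec C M z w p = 0

variable (C : Matrix (Fin N) (Fin N) F) (M : ℕ → Matrix (Fin N) (Fin N) F) (z : Fin N → F)
  (p q : Fin N)

/-- The memory holds the weighted automaton with transition matrices `C` and `M` and accepting
states `p` and `q`. -/
structure HoldsAutomaton (m : Memory F) : Prop where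
  size : m.idx 6 0 0 = N
  const : constMatrix N m = C
  var : varMatrix N m = M
  left : m.idx 19 0 0 = p
  right : m.idx 20 0 0 = q

/-- The span of the basis vectors in memory. -/
def rowSpan (N : ℕ) (m : Memory F) : Submodule F (Fin N → F) :=
  Submodule.span F (row N m '' {l | l < m.idx 10 0 0})

/-- The memory holds linearly independent vectors, in echelon form, from the span of the state
vectors, the first of them the vector of the empty word; if the output cell is not `1`, then a
weight that does not vanish has been found. -/
structure PartialBasis (m : Memory F) : Prop where
  pos : 0 < m.idx 10 0 0
  first : row N m 0 = stateVec C M z []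
  mem : ∀ l < m.idx 10 0 0, row N m l ∈ Submodule.span F (Set.range (stateVec C M z))
  pivot : ∀ l < m.idx 10 0 0, ∃ v : Fin N, m.idx 9 l 0 = v ∧ row N m l v = 1 ∧
    ∀ l', l < l' → l' < m.idx 10 0 0 → row N m l' v = 0
  output : m.idx 5 0 0 = 1 ∨ (m.idx 5 0 0 = 0 ∧ ¬ Vanishes C M z p q)

/-- The vector `y`, obtained from row `k` by reading a letter, is no witness against vanishing. -/
def Passes (k : ℕ) (y : Fin N → F) : Prop := y p + y q = 0 ∧ (k = 0 → y p = 0)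

/-- Row `k` times the letter `x` lies in the span of the basis, and passes the test if the output
is still `1`. -/
def Tested (k x : ℕ) (m : Memory F) : Prop :=
  letterMap C M x (row N m k) ∈ rowSpan N m ∧
    (m.idx 5 0 0 = 1 → Passes p q k (letterMap C M x (row N m k)))

variable {C M z p q} {m m' : Memory F}

theorem HoldsAutomaton.frame (h : HoldsAutomaton C M p q m) {A B : List ℕ} (hF : Frame A B m m')
    (hA : ∀ a ∈ [6, 7, 8, 19, 20], a ∉ A := by decide) (hB : 1 ∉ B := by decide) :
    HoldsAutomaton C M p q m' where
  size := by rw [hF.1 6 (hA _ (by decide)), h.size]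
  const := by rw [← h.const]; unfold constMatrix; rw [hF.2 1 hB]
  var := by
    rw [← h.var]
    unfold varMatrix
    rw [hF.1 7 (hA _ (by decide)), hF.1 8 (hA _ (by decide))]
  left := by rw [hF.1 19 (hA _ (by decide)), h.left]
  right := by rw [hF.1 20 (hA _ (by decide)), h.right]

theorem rowSpan_congr (h : m'.idx 10 = m.idx 10) (h' : m'.fld 3 = m.fld 3) :
    rowSpan N m' = rowSpan N m := by
  unfold rowSpan
  rw [row_congr h', h]

theorem PartialBasis.congr (h : PartialBasis C M z p q m) (h5 : m'.idx 5 = m.idx 5)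
    (h9 : m'.idx 9 = m.idx 9) (h10 : m'.idx 10 = m.idx 10) (h3 : m'.fld 3 = m.fld 3) :
    PartialBasis C M z p q m' := by
  refine ⟨?_, ?_, ?_, ?_, ?_⟩
  · rw [h10]; exact h.pos
  · rw [row_congr h3]; exact h.first
  · rw [row_congr h3, h10]; exact h.mem
  · rw [row_congr h3, h10, h9]; exact h.pivot
  · rw [h5]; exact h.output

theorem Tested.congr {k x : ℕ} (h : Tested C M p q k x m) (h5 : m'.idx 5 = m.idx 5)
    (h10 : m'.idx 10 = m.idx 10) (h3 : m'.fld 3 = m.fld 3) : Tested C M p q k x m' := by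
  unfold Tested
  rw [row_congr h3, h5, rowSpan_congr h10 h3]
  exact h

theorem Grows.rowSpan_le (h : Grows N m m') : rowSpan N m ≤ rowSpan N m' := by
  refine Submodule.span_le.2 ?_
  rintro _ ⟨l, hl, rfl⟩
  rw [← h.row l hl]
  exact Submodule.subset_span ⟨l, lt_of_lt_of_le hl h.le, rfl⟩

/-- Rows are only appended and the output never returns to `1`, so what has been tested once need
not be tested again. -/
theorem Tested.mono {k x : ℕ} (h : Tested C M p q k x m) (hk : k < m.idx 10 0 0)
    (hg : Grows N m m') : Tested C M p q k x m' := by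
  unfold Tested
  rw [hg.row k hk]
  exact ⟨hg.rowSpan_le h.1, fun h5 => h.2 (hg.output h5)⟩

/-- Pivots are distinct: the later of two rows vanishes at the pivot of the earlier one and is `1`
at its own. -/
theorem PartialBasis.le (h : PartialBasis C M z p q m) : m.idx 10 0 0 ≤ N := by
  choose f hf using fun l : Fin (m.idx 10 0 0) => h.pivot l l.2
  have hinj : Function.Injective f := by
    have hlt : ∀ a b : Fin (m.idx 10 0 0), a < b → f a ≠ f b := by
      intro a b hab he
      have h1 := (hf a).2.2 b hab b.2
      rw [he, (hf b).2.1] at h1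
      exact one_ne_zero h1
    intro a b he
    rcases lt_trichotomy a b with hab | hab | hab
    · exact absurd he (hlt _ _ hab)
    · exact hab
    · exact absurd he.symm (hlt _ _ hab)
  simpa using Fintype.card_le_of_injective f hinj

theorem letterMap_mem_span {y : Fin N → F} (x : ℕ)
    (h : y ∈ Submodule.span F (Set.range (stateVec C M z))) :
    letterMap C M x y ∈ Submodule.span F (Set.range (stateVec C M z)) := by
  induction h using Submodule.span_induction with
  | mem y hy =>
    obtain ⟨w, rfl⟩ := hy
    exact Submodule.subset_span ⟨x :: w, rfl⟩
  | zero => simp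
  | add y y' _ _ h h' => rw [map_add]; exact add_mem h h'
  | smul a y _ h => rw [map_smul]; exact Submodule.smul_mem _ _ h

/-- Used in contrapositive form: a failed test certifies that some weight does not vanish. The sum
test is linear, so it applies to combinations of state vectors. The short test needs genuine state
vectors; row `0` is the unscaled vector of the empty word, so its images are those of the one-letter
words. -/
theorem PartialBasis.passes (h : PartialBasis C M z p q m) (hv : Vanishes C M z p q) {k : ℕ}
    (hk : k < m.idx 10 0 0) (x : ℕ) : Passes p q k (letterMap C M x (row N m k)) := by
  constructor
  · have hle : Submodule.span F (Set.range (stateVec C M z)) ≤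
        LinearMap.ker ((LinearMap.proj p : (Fin N → F) →ₗ[F] F) + LinearMap.proj q) := by
      rw [Submodule.span_le]
      rintro _ ⟨w, rfl⟩
      simpa using hv.1 w
    simpa using hle (letterMap_mem_span x (h.mem k hk))
  · rintro rfl
    rw [h.first]
    exact hv.2 [x] (by simp)

/-- The span of the rows contains the vector of the empty word and is stable under letters, so it
contains every state vector; by linearity it suffices to have tested the images of the rows. -/
theorem PartialBasis.vanishes (h : PartialBasis C M z p q m) (h1 : m.idx 5 0 0 = 1)
    (hp : Passes p q 0 (stateVec C M z []))
    (ht : ∀ k < m.idx 10 0 0, ∀ x, Tested C M p q k x m) : Vanishes C M z p q := by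
  have hstep : ∀ x, ∀ y ∈ rowSpan N m, letterMap C M x y ∈ rowSpan N m ∧
      letterMap C M x y p + letterMap C M x y q = 0 := by
    intro x y hy
    induction hy using Submodule.span_induction with
    | mem y hy =>
      obtain ⟨k, hk, rfl⟩ := hy
      exact ⟨(ht k hk x).1, ((ht k hk x).2 h1).1⟩
    | zero => simp
    | add y y' _ _ h h' =>
      rw [map_add]
      refine ⟨add_mem h.1 h'.1, ?_⟩
      rw [Pi.add_apply, Pi.add_apply, add_add_add_comm, h.2, h'.2, add_zero]
    | smul a y _ h =>
      rw [map_smul]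
      refine ⟨Submodule.smul_mem _ _ h.1, ?_⟩
      rw [Pi.smul_apply, Pi.smul_apply, ← smul_add, h.2, smul_zero]
  have hmem : ∀ w, stateVec C M z w ∈ rowSpan N m := by
    intro w
    induction w with
    | nil => exact h.first ▸ Submodule.subset_span ⟨0, h.pos, rfl⟩
    | cons x w ih => exact (hstep x _ ih).1
  constructor
  · rintro (_ | ⟨x, w⟩)
    · exact hp.1
    · exact (hstep x _ (hmem w)).2
  · rintro (_ | ⟨x, _ | ⟨_, _⟩⟩) hw
    · exact hp.2 rfl
    · have := ((ht 0 h.pos x).2 h1).2 rfl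
      rwa [h.first] at this
    · simp at hw

theorem spec_checkSum (h : HoldsAutomaton C M p q m) : Spec N checkSum m (fun m' =>
    Frame [5] [] m m' ∧ (vec N m 2 p + vec N m 2 q = 0 → m'.idx 5 0 0 = m.idx 5 0 0) ∧
      (vec N m 2 p + vec N m 2 q ≠ 0 → m'.idx 5 0 0 = 0)) := by
  have hb : (Test.fldZero (.add (ventry 2 19) (ventry 2 20))).Holds m ↔
      vec N m 2 p + vec N m 2 q = 0 := by
    simp [Test.Holds, FldExpr.eval, IdxExpr.eval, ventry, vec, h.left, h.right]
  refine Spec.ite (fun hc => Spec.skip ⟨Frame.refl _ _ _, fun _ => rfl, fun hn => ?_⟩)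
    (fun hc => Spec.assign ⟨(Frame.refl _ _ _).setIdx _ _ _, fun hn => ?_, fun _ => ?_⟩)
  · exact absurd (hb.1 hc) hn
  · exact absurd (hb.2 hn) hc
  · simp [IdxExpr.eval]

theorem spec_checkShort (h : HoldsAutomaton C M p q m) : Spec N checkShort m (fun m' =>
    Frame [5] [] m m' ∧ (vec N m 2 p = 0 → m'.idx 5 0 0 = m.idx 5 0 0) ∧
      (vec N m 2 p ≠ 0 → m'.idx 5 0 0 = 0)) := by
  have hb : (Test.fldZero (ventry 2 19)).Holds m ↔ vec N m 2 p = 0 := by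
    simp [Test.Holds, FldExpr.eval, IdxExpr.eval, ventry, vec, h.left]
  refine Spec.ite (fun hc => Spec.skip ⟨Frame.refl _ _ _, fun _ => rfl, fun hn => ?_⟩)
    (fun hc => Spec.assign ⟨(Frame.refl _ _ _).setIdx _ _ _, fun hn => ?_, fun _ => ?_⟩)
  · exact absurd (hb.1 hc) hn
  · exact absurd (hb.2 hn) hc
  · simp [IdxExpr.eval]

/-- Subtracting a multiple of row `i` clears its pivot and leaves the earlier pivots clear, since
row `i` vanishes there. -/
theorem spec_reduce (hN : m.idx 6 0 0 = N) (hr : m.idx 10 0 0 ≤ N)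
    (hpiv : ∀ l < m.idx 10 0 0, ∃ v : Fin N, m.idx 9 l 0 = v ∧ row N m l v = 1 ∧
      ∀ l', l < l' → l' < m.idx 10 0 0 → row N m l' v = 0) :
    Spec N reduce m (fun m' => Frame [14, 21] [2, 4] m m' ∧
      vec N m 2 - vec N m' 2 ∈ rowSpan N m ∧
      ∀ l < m.idx 10 0 0, ∀ v : Fin N, m.idx 9 l 0 = v → vec N m' 2 v = 0) := by
  refine Spec.forLoop hr
    (fun i m' => Frame [14, 21] [2, 4] m m' ∧ vec N m 2 - vec N m' 2 ∈ rowSpan N m ∧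
      ∀ l < i, ∀ v : Fin N, m.idx 9 l 0 = v → vec N m' 2 v = 0)
    ⟨(Frame.refl _ _ _).setIdx _ _ _, ?_, by simp⟩ ?_ ?_
  · rw [vec_setIdx, sub_self]
    exact zero_mem _
  · rintro i m' ⟨hF, -⟩
    rw [eval_cell, hF.idx 10]
  rintro i hi m' ⟨hF, hmem, hzero⟩ hc
  obtain ⟨v, hv, hone, hlater⟩ := hpiv i hi
  -- The factor is saved first, because the loop overwrites the entry of `y` at the pivot.
  refine Spec.seq (Spec.setFld ((Spec.forLoop le_rfl
    (fun j m'' => Frame [14] [2, 4] m' m'' ∧ m''.fld 4 0 0 = vec N m' 2 v ∧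
      (∀ w : Fin N, w < j → vec N m'' 2 w = vec N m' 2 w - vec N m' 2 v * row N m i w) ∧
      ∀ w : Fin N, j ≤ w → vec N m'' 2 w = vec N m' 2 w)
    ⟨((Frame.refl _ _ _).setFld _ _ _).setIdx _ _ _, ?_, by simp, ?_⟩ ?_ ?_).mono ?_))
  · simp [FldExpr.eval, IdxExpr.eval, hc, hF.idx 9, hv, vec]
  · intro w _
    simp [vec]
  · rintro j m'' ⟨hF', -⟩
    rw [eval_cell, hF'.idx 6, hF.idx 6, hN]
  · rintro j hj m'' ⟨hF', ht, hlt, hge⟩ hc'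
    refine Spec.setFld ⟨by simpa using hc', (hF'.setFld _ _ _).setIdx _ _ _, by simpa using ht,
      fun w hw => ?_, fun w hw => ?_⟩
    · by_cases h : (w : ℕ) = j
      · rw [← hge w h.ge, ← ht]
        simp [vec, h, hc', FldExpr.eval, IdxExpr.eval, ventry, fcell, entry, row, hF'.idx 21, hc,
          hF'.fld 3, hF.fld 3]
      · rw [← hlt w (by omega)]
        simp [vec, h, hc']
    · rw [← hge w (by omega)]
      simp [vec, hc', show (w : ℕ) ≠ j by omega]
  · rintro m'' ⟨hF', -, hlt, -⟩
    refine ⟨by rw [hF'.idx 21, hc], (hF.trans hF').setIdx _ _ _, ?_, fun l hl w hw => ?_⟩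
    · have : vec N m 2 - vec N m'' 2 =
          (vec N m 2 - vec N m' 2) + vec N m' 2 v • row N m i := by
        funext w
        simp only [Pi.sub_apply, Pi.add_apply, Pi.smul_apply, smul_eq_mul, hlt w w.2]
        ring
      rw [vec_setIdx, this]
      exact add_mem hmem (Submodule.smul_mem _ _ (Submodule.subset_span ⟨i, hi, rfl⟩))
    · rw [vec_setIdx, hlt w w.2]
      rcases Nat.lt_succ_iff_lt_or_eq.1 hl with hl | rfl
      · obtain ⟨v', hv', -, hz⟩ := hpiv l (hl.trans hi)
        obtain rfl : v' = w := Fin.ext (hv'.symm.trans hw)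
        rw [hzero l hl _ hw, hz i hl hi, mul_zero, sub_zero]
      · obtain rfl : v = w := Fin.ext (hv.symm.trans hw)
        rw [hone, mul_one, sub_self]

end ZeroTest

/-! ### Closing the basis under letters -/

section ZeroTest

open Matrix

variable {F : Type u} [Field F] {N : ℕ} {C : Matrix (Fin N) (Fin N) F}
  {M : ℕ → Matrix (Fin N) (Fin N) F} {z : Fin N → F} {p q : Fin N} {m m' : Memory F}

theorem spec_check (h : HoldsAutomaton C M p q m) : Spec N check m (fun m' =>
    Frame [5] [] m m' ∧
      (Passes p q (m.idx 11 0 0) (vec N m 2) → m'.idx 5 0 0 = m.idx 5 0 0) ∧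
      (¬ Passes p q (m.idx 11 0 0) (vec N m 2) → m'.idx 5 0 0 = 0)) := by
  refine Spec.seq ((spec_checkSum h).mono ?_)
  rintro m₁ ⟨hF, h1, h2⟩
  have hv : vec N m₁ 2 = vec N m 2 := vec_congr (hF.fld 2)
  have hb : (Test.idxEq (cell 11) (.const 0)).Holds m₁ ↔ m.idx 11 0 0 = 0 := by
    simp [Test.Holds, IdxExpr.eval, hF.idx 11]
  refine Spec.ite (fun hc => (spec_checkShort (h.frame hF)).mono ?_)
    (fun hc => Spec.skip ⟨hF, fun hp => h1 hp.1, fun hp => h2 fun h0 => hp ⟨h0, fun hk => ?_⟩⟩)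
  · rintro m₂ ⟨hF', h1', h2'⟩
    rw [hv] at h1' h2'
    refine ⟨hF.trans hF', fun hp => ?_, fun hp => ?_⟩
    · rw [h1' (hp.2 (hb.1 hc)), h1 hp.1]
    · by_cases h0 : vec N m 2 p = 0
      · rw [h1' h0, h2 fun hs => hp ⟨hs, fun _ => h0⟩]
      · exact h2' h0
  · exact absurd hk (hb.not.1 hc)

theorem PartialBasis.check {k : ℕ} {x : ℕ} (h : PartialBasis C M z p q m)
    (hk : k < m.idx 10 0 0) (h9 : m'.idx 9 = m.idx 9) (h10 : m'.idx 10 = m.idx 10)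
    (h3 : m'.fld 3 = m.fld 3)
    (hp : Passes p q k (letterMap C M x (row N m k)) → m'.idx 5 0 0 = m.idx 5 0 0)
    (hn : ¬ Passes p q k (letterMap C M x (row N m k)) → m'.idx 5 0 0 = 0) :
    PartialBasis C M z p q m' := by
  refine ⟨?_, ?_, ?_, ?_, ?_⟩
  · rw [h10]; exact h.pos
  · rw [row_congr h3]; exact h.first
  · rw [row_congr h3, h10]; exact h.mem
  · rw [row_congr h3, h10, h9]; exact h.pivot
  · by_cases hps : Passes p q k (letterMap C M x (row N m k))
    · rw [hp hps]; exact h.output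
    · exact Or.inr ⟨hn hps, fun hv => hps (h.passes hv hk x)⟩

/-- The echelon form survives because `y` is already zero at all old pivots. -/
theorem PartialBasis.push (h : PartialBasis C M z p q m) {y : Fin N → F} {v : Fin N}
    (hy : y ∈ Submodule.span F (Set.range (stateVec C M z))) (hv : y v ≠ 0)
    (hz : ∀ l < m.idx 10 0 0, ∀ w : Fin N, m.idx 9 l 0 = w → y w = 0)
    (h5 : m'.idx 5 = m.idx 5) (h10 : m'.idx 10 0 0 = m.idx 10 0 0 + 1)
    (h9 : m'.idx 9 (m.idx 10 0 0) 0 = v) (h9' : ∀ l ≠ m.idx 10 0 0, m'.idx 9 l 0 = m.idx 9 l 0)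
    (h3 : row N m' (m.idx 10 0 0) = (y v)⁻¹ • y)
    (h3' : ∀ l ≠ m.idx 10 0 0, row N m' l = row N m l) : PartialBasis C M z p q m' := by
  refine ⟨by omega, ?_, fun l hl => ?_, fun l hl => ?_, by rw [h5]; exact h.output⟩
  · rw [h3' 0 h.pos.ne]
    exact h.first
  · by_cases hlr : l = m.idx 10 0 0
    · rw [hlr, h3]
      exact Submodule.smul_mem _ _ hy
    · rw [h3' l hlr]
      exact h.mem l (by omega)
  · by_cases hlr : l = m.idx 10 0 0
    · refine ⟨v, by rw [hlr, h9], ?_, fun l' h1 h2 => by omega⟩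
      rw [hlr, h3, Pi.smul_apply, smul_eq_mul, inv_mul_cancel₀ hv]
    · obtain ⟨w, hw, hone, hlater⟩ := h.pivot l (by omega)
      refine ⟨w, by rw [h9' l hlr, hw], by rw [h3' l hlr, hone], fun l' h1 h2 => ?_⟩
      by_cases hlr' : l' = m.idx 10 0 0
      · rw [hlr', h3, Pi.smul_apply, hz l (by omega) w hw, smul_zero]
      · rw [h3' l' hlr']
        exact hlater l' h1 (by omega)

/-- The test is made on the product before its reduction, as the short test needs the exact state
vector. If the reduced vector is zero, the product lies in the span already; otherwise the new row
puts it there. -/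
theorem spec_extend (h : HoldsAutomaton C M p q m) {rk : Fin N → ℕ}
    (hrk : ∀ u v, C u v ≠ 0 → rk u < rk v) (hB : PartialBasis C M z p q m) {k x : ℕ}
    (hk : m.idx 11 0 0 = k) (hkr : k < m.idx 10 0 0) (hx : m.idx 17 0 0 = x) :
    Spec N extend m (fun m' => Frame [5, 9, 10, 14, 15, 16, 18, 21] [2, 3, 4, 5] m m' ∧
      PartialBasis C M z p q m' ∧ Grows N m m' ∧ Tested C M p q k x m') := by
  have hyW := letterMap_mem_span x (hB.mem k hkr)
  have hstep : (row N m k ᵥ* M x) ᵥ* (1 - C)⁻¹ = letterMap C M x (row N m k) := by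
    rw [Matrix.vecMul_vecMul]
    rfl
  set y := letterMap C M x (row N m k) with hy
  refine Spec.seq ((spec_readLetter h.size).mono ?_)
  rintro m₁ ⟨hF₁, h₁⟩
  have H₁ := h.frame hF₁
  refine Spec.seq ((spec_solve H₁.size (rk := rk) (by rw [H₁.const]; exact hrk)).mono ?_)
  rintro m₂ ⟨hF₂, h₂⟩
  have H₂ := H₁.frame hF₂
  rw [h₁, H₁.const, h.var, hk, hx, hstep] at h₂
  have hF₂' : Frame [14, 15, 16] [2, 4, 5] m m₂ := (hF₁.mono).trans hF₂
  refine Spec.seq ((spec_check H₂).mono ?_)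
  rintro m₃ ⟨hF₃, hp₃, hn₃⟩
  rw [h₂, hF₂'.idx 11, hk, hF₂'.idx 5] at hp₃
  rw [h₂, hF₂'.idx 11, hk] at hn₃
  have H₃ := H₂.frame hF₃
  have hF₃' : Frame [5, 14, 15, 16] [2, 4, 5] m m₃ := (hF₂'.mono).trans hF₃
  have hB₃ : PartialBasis C M z p q m₃ :=
    hB.check hkr (hF₃'.idx 9) (hF₃'.idx 10) (hF₃'.fld 3) hp₃ hn₃
  have hG₃ : Grows N m m₃ := by
    refine ⟨by rw [hF₃'.idx 10], fun _ _ => by rw [row_congr (hF₃'.fld 3)], fun h1 => ?_⟩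
    by_cases hps : Passes p q k y
    · rwa [← hp₃ hps]
    · rw [hn₃ hps] at h1
      exact absurd h1 zero_ne_one
  refine Spec.seq ((spec_reduce H₃.size hB₃.le hB₃.pivot).mono ?_)
  rintro m₄ ⟨hF₄, hmem, hzero⟩
  have H₄ := H₃.frame hF₄
  rw [vec_congr (hF₃.fld 2), h₂] at hmem
  refine Spec.seq ((spec_findPivot H₄.size).mono ?_)
  rintro m₅ ⟨hF₅, hpiv⟩
  have H₅ := H₄.frame hF₅
  have hF₅' : Frame [14, 18, 21] [2, 4] m₃ m₅ := (hF₄.mono).trans hF₅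
  have hB₅ : PartialBasis C M z p q m₅ :=
    hB₃.congr (hF₅'.idx 5) (hF₅'.idx 9) (hF₅'.idx 10) (hF₅'.fld 3)
  have hF₆ : Frame [5, 9, 10, 14, 15, 16, 18, 21] [2, 3, 4, 5] m m₅ := (hF₃'.mono).trans hF₅'
  have hr₅ : m₅.idx 10 0 0 = m₃.idx 10 0 0 := by rw [hF₅'.idx 10]
  have hrow₅ : row N m₅ = row N m₃ := row_congr (hF₅'.fld 3)
  have hspan₅ : rowSpan N m₅ = rowSpan N m₃ := rowSpan_congr (hF₅'.idx 10) (hF₅'.fld 3)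
  have hG₅ : Grows N m m₅ :=
    ⟨by rw [hr₅]; exact hG₃.le, fun l hl => by rw [hrow₅]; exact hG₃.row l hl,
      fun h1 => hG₃.output (by rwa [hF₅'.idx 5] at h1)⟩
  have htest : m₃.idx 5 0 0 = 1 → Passes p q k y := fun h1 => by
    by_contra hps
    rw [hn₃ hps] at h1
    exact zero_ne_one h1
  have hrowk : row N m₃ k = row N m k := hG₃.row k hkr
  rcases hpiv with ⟨hpN, hzy⟩ | ⟨v, hpv, hne⟩
  · refine Spec.ite (fun hc => ?_) (fun _ => Spec.skip ⟨hF₆, hB₅, hG₅, ?_⟩)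
    · simp [Test.Holds, hpN, H₅.size] at hc
    · rw [hzy, sub_zero] at hmem
      unfold Tested
      rw [hrow₅, hrowk, hspan₅, ← hy, hF₅'.idx 5]
      exact ⟨hmem, htest⟩
  · refine Spec.ite (fun hc => ?_) (fun hc => ?_)
    · refine (spec_push H₅.size hpv rfl).mono ?_
      rintro m₆ ⟨hF, h10, h9, h9', h3, h3'⟩
      have hvec : vec N m₅ 2 = vec N m₄ 2 := vec_congr (hF₅.fld 2)
      rw [hvec, show m₅.fld 2 v 0 = vec N m₄ 2 v by rw [← hvec]; rfl] at h3
      have hle : rowSpan N m₃ ≤ Submodule.span F (Set.range (stateVec C M z)) := by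
        refine Submodule.span_le.2 ?_
        rintro _ ⟨l, hl, rfl⟩
        exact hB₃.mem l hl
      -- Reduction changes `y` only by rows, which lie in the span of the state vectors.
      have hyW₄ : vec N m₄ 2 ∈ Submodule.span F (Set.range (stateVec C M z)) := by
        have := sub_mem hyW (hle hmem)
        rwa [sub_sub_cancel] at this
      have hG₆ : Grows N m₅ m₆ :=
        ⟨by omega, fun l hl => h3' l hl.ne, fun h1 => by rwa [hF.idx 5] at h1⟩
      refine ⟨hF₆.trans hF, hB₅.push hyW₄ hne ?_ (hF.idx 5) h10 h9 h9' h3 h3',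
        ⟨hG₅.le.trans hG₆.le, fun l hl => ?_, fun h1 => hG₅.output (hG₆.output h1)⟩, ?_, ?_⟩
      · rw [hF₅'.idx 9, hF₅'.idx 10]
        exact hzero
      · rw [hG₆.row l (lt_of_lt_of_le hl hG₅.le), hG₅.row l hl]
      · rw [hG₆.row k (lt_of_lt_of_le hkr hG₅.le), hrow₅, hrowk, ← hy]
        have h1 : y - vec N m₄ 2 ∈ rowSpan N m₆ := hG₆.rowSpan_le (hspan₅ ▸ hmem)
        have h2 : vec N m₄ 2 ∈ rowSpan N m₆ := by
          have : row N m₆ (m₅.idx 10 0 0) ∈ rowSpan N m₆ :=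
            Submodule.subset_span ⟨_, by rw [Set.mem_ofPred_eq]; omega, rfl⟩
          rw [h3] at this
          have h4 := Submodule.smul_mem _ (vec N m₄ 2 v) this
          rwa [smul_smul, mul_inv_cancel₀ hne, one_smul] at h4
        have := add_mem h1 h2
        rwa [sub_add_cancel] at this
      · rw [hG₆.row k (lt_of_lt_of_le hkr hG₅.le), hrow₅, hrowk, ← hy, hF.idx 5, hF₅'.idx 5]
        exact htest
    · exact absurd (by simp [Test.Holds, hpv, H₅.size]) hc

/-- Letters on no edge act as zero. So the program need only try the entries of index array `8`, and
its running time does not depend on the number of variables. -/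
theorem letterMap_eq_zero {x : ℕ} (h : HoldsAutomaton C M p q m)
    (hx : ∀ i j : Fin N, m.idx 8 i j ≠ x) (y : Fin N → F) : letterMap C M x y = 0 := by
  have : M x = 0 := by
    rw [← h.var]
    ext i j
    simp [varMatrix, hx i j]
  simp [letterMap, this]

/-- The outer loop runs up to `N`, not up to the initial rank, since rows appended on the way must
be processed too. As the rank never exceeds `N`, every row of the final basis gets its turn. -/
theorem spec_closure (h : HoldsAutomaton C M p q m) {rk : Fin N → ℕ}
    (hrk : ∀ u v, C u v ≠ 0 → rk u < rk v) (hB : PartialBasis C M z p q m) :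
    Spec N closure m (fun m' => PartialBasis C M z p q m' ∧
      (m'.idx 5 0 0 = 1 → m.idx 5 0 0 = 1) ∧
      ∀ k < m'.idx 10 0 0, ∀ x, Tested C M p q k x m') := by
  have hframe : ∀ {m' : Memory F},
      Frame [5, 9, 10, 11, 12, 13, 14, 15, 16, 17, 18, 21] [2, 3, 4, 5] m m' →
      HoldsAutomaton C M p q m' := fun hF => h.frame hF
  refine (Spec.forLoop le_rfl (fun k m' =>
    Frame [5, 9, 10, 11, 12, 13, 14, 15, 16, 17, 18, 21] [2, 3, 4, 5] m m' ∧
      PartialBasis C M z p q m' ∧ (m'.idx 5 0 0 = 1 → m.idx 5 0 0 = 1) ∧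
      ∀ k' < k, k' < m'.idx 10 0 0 → ∀ i j : Fin N, Tested C M p q k' (m.idx 8 i j) m')
    ⟨(Frame.refl _ _ _).setIdx _ _ _, hB.congr rfl rfl rfl rfl, id, by simp⟩ ?_ ?_).mono ?_
  · rintro i m' ⟨hF, -⟩
    exact (hframe hF).size
  · rintro k hk m₁ ⟨hF₁, hB₁, ho₁, ht₁⟩ hc
    refine Spec.ite (fun hb => ?_) (fun hb => Spec.skip ⟨hc, hF₁.setIdx _ _ _,
      hB₁.congr rfl rfl rfl rfl, ho₁, fun k' hk' hkr i j => ?_⟩)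
    · have hkr : k < m₁.idx 10 0 0 := by simpa [Test.Holds, hc] using hb
      refine (Spec.forLoop le_rfl (fun i m₂ =>
        Frame [5, 9, 10, 12, 13, 14, 15, 16, 17, 18, 21] [2, 3, 4, 5] m₁ m₂ ∧
          PartialBasis C M z p q m₂ ∧ Grows N m₁ m₂ ∧
          ∀ i' < i, ∀ j < N, Tested C M p q k (m.idx 8 i' j) m₂)
        ⟨(Frame.refl _ _ _).setIdx _ _ _, hB₁.congr rfl rfl rfl rfl, .of_eq rfl rfl rfl, by simp⟩
        ?_ ?_).mono ?_
      · rintro i m₂ ⟨hF, -⟩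
        exact (hframe (hF₁.trans hF)).size
      · rintro i hi m₂ ⟨hF₂, hB₂, hG₂, ht₂⟩ hc₂
        refine (Spec.forLoop le_rfl (fun j m₃ =>
          Frame [5, 9, 10, 13, 14, 15, 16, 17, 18, 21] [2, 3, 4, 5] m₂ m₃ ∧
            PartialBasis C M z p q m₃ ∧ Grows N m₂ m₃ ∧
            ∀ j' < j, Tested C M p q k (m.idx 8 i j') m₃)
          ⟨(Frame.refl _ _ _).setIdx _ _ _, hB₂.congr rfl rfl rfl rfl, .of_eq rfl rfl rfl,
            by simp⟩ ?_ ?_).mono ?_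
        · rintro j m₃ ⟨hF, -⟩
          exact (hframe (hF₁.trans (hF₂.trans hF))).size
        · rintro j hj m₃ ⟨hF₃, hB₃, hG₃, ht₃⟩ hc₃
          have hF₃' := hF₁.trans (hF₂.trans hF₃)
          have hkr₃ : k < m₃.idx 10 0 0 := lt_of_lt_of_le hkr (hG₂.le.trans hG₃.le)
          refine Spec.seq (Spec.assign ((spec_extend (k := k) (x := m.idx 8 i j)
            ((hframe hF₃').frame ((Frame.refl [17] [] _).setIdx _ _ _)) hrk
            (hB₃.congr rfl rfl rfl rfl) ?_ ?_ ?_).mono ?_))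
          · simp [hF₃.idx 11, hF₂.idx 11, hc]
          · exact hkr₃
          · simp [IdxExpr.eval, hF₃'.idx 8, hF₃.idx 12, hc₂, hc₃]
          · rintro m₄ ⟨hF₄, hB₄, hG₄, ht₄⟩
            have hF₄' : Frame [5, 9, 10, 13, 14, 15, 16, 17, 18, 21] [2, 3, 4, 5] m₃ m₄ :=
              ((Frame.refl _ _ _).setIdx _ _ _).trans hF₄
            have hG₄' : Grows N m₃ m₄ := ⟨hG₄.le, hG₄.row, hG₄.output⟩
            refine ⟨by rw [hF₄.idx 13]; simpa using hc₃, (hF₃.trans hF₄').setIdx _ _ _,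
              hB₄.congr rfl rfl rfl rfl, ⟨hG₃.le.trans hG₄.le, fun l hl => ?_,
                fun h1 => hG₃.output (hG₄.output h1)⟩, fun j' hj' => ?_⟩
            · rw [← hG₃.row l hl, ← hG₄'.row l (lt_of_lt_of_le hl hG₃.le)]
              rfl
            · rcases Nat.lt_succ_iff_lt_or_eq.1 hj' with hj' | rfl
              · exact ((ht₃ j' hj').mono hkr₃ hG₄').congr rfl rfl rfl
              · exact ht₄.congr rfl rfl rfl
        · rintro m₃ ⟨hF₃, hB₃, hG₃, ht₃⟩
          refine ⟨by rw [hF₃.idx 12, hc₂], (hF₂.trans hF₃).setIdx _ _ _,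
            hB₃.congr rfl rfl rfl rfl, ⟨hG₂.le.trans hG₃.le, fun l hl => ?_,
              fun h1 => hG₂.output (hG₃.output h1)⟩, fun i' hi' j hj => ?_⟩
          · rw [← hG₂.row l hl, ← hG₃.row l (lt_of_lt_of_le hl hG₂.le)]
            rfl
          · rcases Nat.lt_succ_iff_lt_or_eq.1 hi' with hi' | rfl
            · exact ((ht₂ i' hi' j hj).mono (lt_of_lt_of_le hkr hG₂.le) hG₃).congr rfl rfl rfl
            · exact (ht₃ j hj).congr rfl rfl rfl
      · rintro m₂ ⟨hF₂, hB₂, hG₂, ht₂⟩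
        refine ⟨by rw [hF₂.idx 11, hc], (hF₁.trans hF₂).setIdx _ _ _,
          hB₂.congr rfl rfl rfl rfl, fun h1 => ho₁ (hG₂.output h1), fun k' hk' _ i j => ?_⟩
        rcases Nat.lt_succ_iff_lt_or_eq.1 hk' with hk' | rfl
        · exact ((ht₁ k' hk' (hk'.trans hkr) i j).mono (hk'.trans hkr) hG₂).congr rfl rfl rfl
        · exact (ht₂ i i.2 j j.2).congr rfl rfl rfl
    · have hb' : ¬ k < m₁.idx 10 0 0 := by simpa [Test.Holds, hc] using hb
      have hkr' : k' < m₁.idx 10 0 0 := hkr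
      exact (ht₁ k' (by omega) hkr' i j).congr rfl rfl rfl
  · rintro m₁ ⟨hF₁, hB₁, ho₁, ht₁⟩
    refine ⟨hB₁, ho₁, fun k hk x => ?_⟩
    by_cases hx : ∃ i j : Fin N, m.idx 8 i j = x
    · obtain ⟨i, j, rfl⟩ := hx
      exact ht₁ k (lt_of_lt_of_le hk hB₁.le) hk i j
    · push Not at hx
      unfold Tested
      rw [letterMap_eq_zero h hx]
      exact ⟨zero_mem _, fun _ => ⟨by simp, fun _ => rfl⟩⟩

theorem spec_initBasis (hN : m.idx 6 0 0 = N) :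
    Spec N initBasis m (fun m' => Frame [9, 10, 14] [3] m m' ∧ m'.idx 10 0 0 = 1 ∧
      m'.idx 9 0 0 = m.idx 0 0 2 ∧ row N m' 0 = vec N m 2) := by
  refine Spec.seq ((Spec.forLoop le_rfl
    (fun i m' => Frame [14] [3] m m' ∧ ∀ v : Fin N, v < i → row N m' 0 v = vec N m 2 v)
    ⟨(Frame.refl _ _ _).setIdx _ _ _, by simp⟩ ?_ ?_).mono ?_)
  · rintro i m' ⟨hF, -⟩
    rw [eval_cell, hF.idx 6, hN]
  · rintro i hi m' ⟨hF, hlt⟩ hc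
    refine Spec.setFld ⟨by simpa using hc, (hF.setFld _ _ _).setIdx _ _ _, fun v hv => ?_⟩
    by_cases h : (v : ℕ) = i
    · simp [row, h, hc, FldExpr.eval, IdxExpr.eval, ventry, vec, hF.fld 2]
    · rw [← hlt v (by omega)]
      simp [row, h, hc, IdxExpr.eval]
  · rintro m' ⟨hF, hlt⟩
    refine Spec.seq (Spec.setIdx (Spec.assign
      ⟨(hF.mono.setIdx _ _ _).setIdx _ _ _, ?_, ?_, funext fun v => hlt v v.2⟩))
    · simp [IdxExpr.eval]
    · simp [IdxExpr.eval, hF.idx 0]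

/-- The empty word is tested with cell `11` equal to `0`, so the short test covers it. Its vector
has the entry `1` at `s` and can serve as row `0` without scaling. -/
theorem spec_zeroTest (h : HoldsAutomaton C M p q m) {rk : Fin N → ℕ}
    (hrk : ∀ u v, C u v ≠ 0 → rk u < rk v) (hz : vec N m 5 = z) {s : Fin N}
    (hs : m.idx 0 0 2 = s) (hzs : stateVec C M z [] s = 1) :
    Spec N zeroTest m (fun m' => (m'.idx 5 0 0 = 1 ∧ Vanishes C M z p q) ∨
      (m'.idx 5 0 0 = 0 ∧ ¬ Vanishes C M z p q)) := by
  refine Spec.seq ((spec_solve h.size (rk := rk) (by rw [h.const]; exact hrk)).mono ?_)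
  rintro m₁ ⟨hF₁, hy⟩
  rw [hz, h.const] at hy
  have H₁ := h.frame hF₁
  refine Spec.seq ((spec_initBasis H₁.size).mono ?_)
  rintro m₂ ⟨hF₂, h10, h9, h3⟩
  have H₂ := H₁.frame hF₂
  refine Spec.seq (Spec.assign (Spec.seq (Spec.assign (Spec.seq
    ((spec_check (H₂.frame (((Frame.refl [5, 11] [] _).setIdx _ _ _).setIdx _ _ _))).mono ?_)))))
  rintro m₃ ⟨hF₃, hp, hn⟩
  have hv : ∀ a b, vec N ((m₂.setIdx 5 0 0 a).setIdx 11 0 0 b) 2 = stateVec C M z [] := by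
    intro a b
    exact (vec_congr (hF₂.fld 2)).trans hy
  have hF₃' : Frame [5, 11] [] m₂ m₃ :=
    (((Frame.refl _ _ _).setIdx _ _ _).setIdx _ _ _).trans hF₃
  simp only [IdxExpr.eval, hv] at hp hn
  simp only [setIdx_idx_same, and_self, if_true] at hp hn
  simp at hp
  have hB : PartialBasis C M z p q m₃ := by
    have hrow : row N m₃ 0 = stateVec C M z [] := by
      rw [row_congr (hF₃'.fld 3), h3]
      exact hy
    have h10' : m₃.idx 10 0 0 = 1 := by rw [hF₃'.idx 10, h10]
    refine ⟨by omega, hrow, fun l hl => ?_, fun l hl => ?_, ?_⟩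
    · obtain rfl : l = 0 := by omega
      rw [hrow]
      exact Submodule.subset_span ⟨[], rfl⟩
    · obtain rfl : l = 0 := by omega
      refine ⟨s, ?_, by rw [hrow, hzs], fun l' h1 h2 => by omega⟩
      rw [hF₃'.idx 9, h9, hF₁.idx 0, hs]
    · by_cases hps : Passes p q 0 (stateVec C M z [])
      · exact Or.inl (hp hps)
      · exact Or.inr ⟨hn hps, fun hvan => hps ⟨hvan.1 [], fun _ => hvan.2 [] (by simp)⟩⟩
  refine (spec_closure (H₂.frame hF₃') hrk hB).mono ?_
  rintro m₄ ⟨hB₄, ho, ht⟩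
  rcases hB₄.output with h1 | h0
  · refine Or.inl ⟨h1, hB₄.vanishes h1 ?_ ht⟩
    by_contra hps
    have := ho h1
    rw [hn hps] at this
    exact zero_ne_one this
  · exact Or.inr h0

end ZeroTest

/-! ## Words read by a branching program -/

section Words

open Matrix

variable {F : Type u} [Field F]

theorem pow_apply_eq_sum_paths {R V : Type*} [CommSemiring R] [Fintype V] [DecidableEq V]
    (W : Matrix V V R) (k : ℕ) (u v : V) :
    (W ^ k) u v = ∑ p : Fin (k + 1) → V, if p 0 = u ∧ p (Fin.last k) = v then
      ∏ i : Fin k, W (p i.castSucc) (p i.succ) else 0 := by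
  induction k generalizing u with
  | zero =>
    rw [← (Equiv.funUnique (Fin 1) V).symm.sum_comp]
    simp [Matrix.one_apply, ite_and]
  | succ k ih =>
    rw [pow_succ', Matrix.mul_apply, ← (Fin.consEquiv fun _ => V).sum_comp,
      Fintype.sum_prod_type]
    simp only [ih, Finset.mul_sum]
    rw [Finset.sum_comm, Finset.sum_comm (s := (Finset.univ : Finset V))]
    refine Finset.sum_congr rfl fun q _ => ?_
    have h1 : ∀ x, (Fin.consEquiv fun _ : Fin (k + 1 + 1) => V) (x, q) (Fin.last (k + 1)) =
        q (Fin.last k) := fun x => by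
      rw [← Fin.succ_last]
      rfl
    simp only [h1, Fin.prod_univ_succ]
    simp [Fin.consEquiv, ite_and]

/-- The coefficient matrices of the words in the `k`-th power of the matrix `C + ∑ x, x • M x`
over noncommuting variables `x`. -/
def coeffMatrix {V : Type*} [Fintype V] [DecidableEq V] (C : Matrix V V F)
    (M : ℕ → Matrix V V F) : ℕ → List ℕ → Matrix V V F
  | 0, [] => 1
  | 0, _ :: _ => 0
  | k + 1, [] => C * coeffMatrix C M k []
  | k + 1, x :: w => C * coeffMatrix C M k (x :: w) + M x * coeffMatrix C M k w

/-- The total weights of a word. -/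
noncomputable def wordMatrix {V : Type*} [Fintype V] [DecidableEq V] (C : Matrix V V F)
    (M : ℕ → Matrix V V F) : List ℕ → Matrix V V F
  | [] => (1 - C)⁻¹
  | x :: w => (1 - C)⁻¹ * M x * wordMatrix C M w

section Automaton

variable {V : Type*} [Fintype V] [DecidableEq V] {C : Matrix V V F} {M : ℕ → Matrix V V F}

/-- `wordMatrix` recurses on the first letter, while the forward copy of the program extends words
at their end. -/
theorem wordMatrix_append_singleton (w : List ℕ) (x : ℕ) :
    wordMatrix C M (w ++ [x]) = wordMatrix C M w * (M x * (1 - C)⁻¹) := by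
  induction w with
  | nil => simp [wordMatrix, Matrix.mul_assoc]
  | cons y w ih => simp [wordMatrix, ih, Matrix.mul_assoc]

/-- This is the geometric series for `(1 - C - ∑ x, x • M x)⁻¹`, which breaks off after the power
`D`. Summing the recursion of `coeffMatrix` over `k` gives the recursion of `wordMatrix`, multiplied
by `1 - C`. -/
theorem wordMatrix_eq_sum (hC : IsUnit (1 - C)) {D : ℕ}
    (hD : ∀ w, coeffMatrix C M (D + 1) w = 0) (w : List ℕ) :
    wordMatrix C M w = ∑ k ∈ Finset.range (D + 1), coeffMatrix C M k w := by
  have hd : IsUnit (1 - C).det := (Matrix.isUnit_iff_isUnit_det _).1 hC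
  have hshift : ∀ w, ∑ k ∈ Finset.range (D + 1), coeffMatrix C M (k + 1) w =
      (∑ k ∈ Finset.range (D + 1), coeffMatrix C M k w) - coeffMatrix C M 0 w := by
    intro w
    rw [eq_sub_iff_add_eq, ← Finset.sum_range_succ' (fun k => coeffMatrix C M k w),
      Finset.sum_range_succ, hD, add_zero]
  induction w with
  | nil =>
    have h := hshift []
    simp only [coeffMatrix, ← Finset.mul_sum] at h
    rw [wordMatrix]
    refine Matrix.inv_eq_right_inv ?_
    rw [Matrix.sub_mul, Matrix.one_mul, h, sub_sub_cancel]
  | cons x w ih =>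
    have h := hshift (x :: w)
    simp only [coeffMatrix, Finset.sum_add_distrib, ← Finset.mul_sum, ← ih, sub_zero] at h
    rw [wordMatrix, Matrix.mul_assoc, ← add_sub_cancel_left (C * _) (M x * _), h]
    conv_lhs => rw [← Matrix.one_mul (∑ k ∈ Finset.range (D + 1), coeffMatrix C M k (x :: w)),
      ← Matrix.mul_assoc C, Matrix.mul_one, ← Matrix.sub_mul]
    rw [← Matrix.mul_assoc, Matrix.nonsing_inv_mul _ hd, Matrix.one_mul]

theorem stateVec_submatrix {W : Type*} [Fintype W] [DecidableEq W] (e : W ≃ V) (z : V → F)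
    (w : List ℕ) :
    stateVec (C.submatrix e e) (fun x => (M x).submatrix e e) (z ∘ e) w =
      stateVec C M z w ∘ e := by
  have h1 : (1 - C.submatrix e e)⁻¹ = ((1 - C)⁻¹).submatrix e e := by
    rw [← Matrix.inv_submatrix_equiv]
    congr 1
    ext i j
    simp [Matrix.one_apply]
  have h2 : ∀ a : V → F, (a ∘ e) ∘ e.symm = a := fun a => by
    funext v
    simp
  induction w with
  | nil =>
    rw [stateVec, stateVec, h1, Matrix.submatrix_vecMul_equiv, h2]
  | cons x w ih =>
    rw [stateVec, stateVec, ih]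
    simp only [letterMap, Matrix.vecMulLinear_apply]
    rw [h1, Matrix.submatrix_mul_equiv, Matrix.submatrix_vecMul_equiv, h2]

/-- State vectors consume a word from its last letter. So the forward block, started at `s`, follows
paths that read the reversed word; the transposed block, started at `t`, goes backwards along paths
that read the word itself. -/
theorem stateVec_fromBlocks (hC : IsUnit (1 - C)) (s t : V) (w : List ℕ) :
    stateVec (fromBlocks C 0 0 Cᵀ) (fun x => fromBlocks (M x) 0 0 (M x)ᵀ)
      (Sum.elim (Pi.single s 1) (Pi.single t 1)) w =
      Sum.elim (fun v => wordMatrix C M w.reverse s v) (fun v => wordMatrix C M w v t) := by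
  have hd : IsUnit (1 - C).det := (Matrix.isUnit_iff_isUnit_det _).1 hC
  have hinv : (1 - fromBlocks C 0 0 Cᵀ)⁻¹ = fromBlocks (1 - C)⁻¹ 0 0 ((1 - C)⁻¹)ᵀ := by
    refine Matrix.inv_eq_right_inv ?_
    have h1 : (1 - fromBlocks C 0 0 Cᵀ) = fromBlocks (1 - C) 0 0 (1 - C)ᵀ := by
      rw [← Matrix.fromBlocks_one, Matrix.transpose_sub, Matrix.transpose_one]
      ext (i | i) (j | j) <;> simp [Matrix.one_apply]
    rw [h1, Matrix.fromBlocks_multiply, ← Matrix.transpose_mul, Matrix.mul_nonsing_inv _ hd,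
      Matrix.nonsing_inv_mul _ hd]
    simp
  induction w with
  | nil =>
    rw [stateVec, hinv, Matrix.vecMul_fromBlocks]
    funext v
    rcases v with v | v <;> simp [wordMatrix]
  | cons x w ih =>
    rw [stateVec, ih]
    simp only [letterMap, Matrix.vecMulLinear_apply]
    rw [hinv, Matrix.fromBlocks_multiply, Matrix.vecMul_fromBlocks]
    simp only [Matrix.mul_zero, Matrix.zero_mul, add_zero, zero_add, Matrix.vecMul_zero,
      ← Matrix.transpose_mul, Matrix.vecMul_transpose, List.reverse_cons,
      wordMatrix_append_singleton]
    rfl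

/-- A word of at most one letter is its own reversal, so the forward block alone gives its weight.
-/
theorem vanishes_fromBlocks (hC : IsUnit (1 - C)) (s t : V) :
    Vanishes (fromBlocks C 0 0 Cᵀ) (fun x => fromBlocks (M x) 0 0 (M x)ᵀ)
      (Sum.elim (Pi.single s 1) (Pi.single t 1)) (Sum.inl t) (Sum.inr s) ↔
      (∀ w, wordMatrix C M w.reverse s t + wordMatrix C M w s t = 0) ∧
        ∀ w, w.length ≤ 1 → wordMatrix C M w s t = 0 := by
  unfold Vanishes
  simp only [stateVec_fromBlocks hC, Sum.elim_inl, Sum.elim_inr]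
  refine and_congr_right fun _ => forall_congr' fun w => imp_congr_right fun hw => ?_
  match w, hw with
  | [], _ => rfl
  | [_], _ => rfl

theorem vanishes_submatrix {W : Type*} [Fintype W] [DecidableEq W] (e : W ≃ V) (z : V → F)
    (p q : V) :
    Vanishes (C.submatrix e e) (fun x => (M x).submatrix e e) (z ∘ e) (e.symm p) (e.symm q) ↔
      Vanishes C M z p q := by
  unfold Vanishes
  simp [stateVec_submatrix]

end Automaton

/-! ### Monotone words and their reversals -/

/-- The words over a multiset of letters. -/
noncomputable def words {n : ℕ} (m : Fin n →₀ ℕ) : Finset (List (Fin n)) := (Finsupp.toMultiset m).lists.toFinset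

theorem mem_words {n : ℕ} {m : Fin n →₀ ℕ} {w : List (Fin n)} :
    w ∈ words m ↔ Finsupp.toMultiset m = (w : Multiset (Fin n)) := by
  rw [words, Multiset.mem_toFinset, Multiset.mem_lists_iff]
  rfl

/-- The words are sorted by their first letter, which mirrors the coefficients of a product with a
variable. The empty word has no first letter, hence `h0`. -/
theorem sum_words {n : ℕ} (m : Fin n →₀ ℕ) (g : List (Fin n) → F) (h0 : g [] = 0) :
    ∑ w ∈ words m, g w =
      ∑ x, if x ∈ m.support then ∑ w ∈ words (m - Finsupp.single x 1), g (x :: w) else 0 := by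
  have hadd : ∀ x ∈ m.support, Finsupp.toMultiset m =
      x ::ₘ Finsupp.toMultiset (m - Finsupp.single x 1) := by
    intro x hx
    have hle : Finsupp.single x 1 ≤ m := by
      rw [Finsupp.single_le_iff]
      exact Nat.one_le_iff_ne_zero.2 (Finsupp.mem_support_iff.1 hx)
    conv_lhs => rw [← add_tsub_cancel_of_le hle]
    rw [Finsupp.toMultiset_add, Finsupp.toMultiset_single, one_nsmul, Multiset.singleton_add]
  rw [← Finset.sum_filter, Finset.sum_sigma']
  symm
  refine Finset.sum_of_injOn (fun a : (_ : Fin n) × List (Fin n) => a.1 :: a.2) ?_ ?_ ?_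
    (fun _ _ => rfl)
  · rintro ⟨x, w⟩ _ ⟨y, w'⟩ _ h
    simp only [List.cons.injEq] at h
    obtain ⟨rfl, rfl⟩ := h
    rfl
  · rintro ⟨x, w⟩ h
    simp only [Finset.coe_sigma, Set.mem_sigma_iff, Finset.mem_coe, Finset.mem_filter,
      Finset.mem_univ, true_and, mem_words] at h
    rw [Finset.mem_coe, mem_words, hadd x h.1, h.2]
    rfl
  · intro w hw hn
    rcases w with _ | ⟨x, w⟩
    · exact h0
    · exfalso
      rw [mem_words] at hw
      have hx : x ∈ m.support := by
        rw [← Finsupp.mem_toMultiset, hw]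
        simp
      refine hn ⟨⟨x, w⟩, ?_, rfl⟩
      simp only [Finset.coe_sigma, Set.mem_sigma_iff, Finset.mem_coe, Finset.mem_filter,
        Finset.mem_univ, true_and, mem_words]
      refine ⟨hx, ?_⟩
      rw [hadd x hx, ← Multiset.cons_coe] at hw
      exact (Multiset.cons_inj_right x).1 hw

theorem pairwise_of_append {α : Type*} {r : α → α → Prop} {w : List α}
    (h : ∀ w₁ w₂, w = w₁ ++ w₂ → ∀ a ∈ w₁, ∀ b ∈ w₂, r a b) : w.Pairwise r := by
  induction w with
  | nil => exact .nil
  | cons x w ih =>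
    refine .cons (h [x] w rfl x (by simp)) (ih fun w₁ w₂ hw a ha => ?_)
    exact h (x :: w₁) w₂ (by rw [hw]; rfl) a (by simp [ha])

/-- The cut after the first letter fixes the direction. Every later cut has the first letter on its
left, so it cannot go the other way. -/
theorem pairwise_lt_or_gt {α : Type*} {f : α → ℕ} {w : List α}
    (h : ∀ w₁ w₂, w = w₁ ++ w₂ → (∀ a ∈ w₁, ∀ b ∈ w₂, f a < f b) ∨
      ∀ a ∈ w₁, ∀ b ∈ w₂, f b < f a) :
    w.Pairwise (fun a b => f a < f b) ∨ w.Pairwise fun a b => f b < f a := by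
  rcases w with _ | ⟨a, w⟩
  · simp
  rcases h [a] w rfl with h0 | h0
  · refine Or.inl (pairwise_of_append fun w₁ w₂ hw => ?_)
    rcases w₁ with _ | ⟨a', w₁⟩
    · simp
    rw [List.cons_append, List.cons.injEq] at hw
    obtain ⟨rfl, hw⟩ := hw
    rcases h (a :: w₁) w₂ (by rw [hw]; rfl) with h1 | h1
    · exact h1
    · intro _ _ b hb
      have h2 := h0 a (by simp) b (by simp [hw, hb])
      have h3 := h1 a (by simp) b hb
      omega
  · refine Or.inr (pairwise_of_append fun w₁ w₂ hw => ?_)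
    rcases w₁ with _ | ⟨a', w₁⟩
    · simp
    rw [List.cons_append, List.cons.injEq] at hw
    obtain ⟨rfl, hw⟩ := hw
    rcases h (a :: w₁) w₂ (by rw [hw]; rfl) with h1 | h1
    · intro _ _ b hb
      have h2 := h0 a (by simp) b (by simp [hw, hb])
      have h3 := h1 a (by simp) b hb
      omega
    · exact h1

theorem perm_eq_of_pairwise_lt {n : ℕ} {f : Fin n → ℕ} {w w' : List (Fin n)} (hp : w'.Perm w)
    (hw : w.Pairwise fun a b => f a < f b) (hw' : w'.Pairwise fun a b => f a < f b) : w' = w :=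
  hp.eq_of_pairwise (fun _ _ _ _ h h' => absurd h (lt_asymm h')) hw' hw

/-- A monotone rearrangement of an increasing word is that word or its reversal; for at most one
letter the two coincide and count once. -/
theorem sum_words_eq {n : ℕ} {f : Fin n → ℕ} {g : List (Fin n) → F}
    (hg : ∀ w, g w ≠ 0 → w.Pairwise (fun a b => f a < f b) ∨ w.Pairwise fun a b => f b < f a)
    {m : Fin n →₀ ℕ} {w : List (Fin n)} (hwm : w ∈ words m)
    (hw : w.Pairwise fun a b => f a < f b) :
    ∑ w' ∈ words m, g w' = if w.length ≤ 1 then g w else g w + g w.reverse := by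
  have honly : ∀ w' ∈ words m, w' ≠ w ∧ w' ≠ w.reverse → g w' = 0 := by
    intro w' hw' hne
    by_contra h0
    rw [mem_words] at hwm hw'
    have hp : w'.Perm w := Multiset.coe_eq_coe.1 (hw'.symm.trans hwm)
    rcases hg w' h0 with h | h
    · exact hne.1 (perm_eq_of_pairwise_lt hp hw h)
    · refine hne.2 ?_
      rw [← perm_eq_of_pairwise_lt ((List.reverse_perm w').trans hp) hw
        (List.pairwise_reverse.2 h), List.reverse_reverse]
  have hrev : w.reverse ∈ words m := by
    rw [mem_words] at hwm ⊢
    rw [hwm]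
    exact (Multiset.coe_eq_coe.2 (List.reverse_perm w)).symm
  split_ifs with hl
  · have hr : w.reverse = w := by
      match w, hl with
      | [], _ => rfl
      | [_], _ => rfl
    refine Finset.sum_eq_single w (fun w' hw' hne => honly w' hw' ⟨hne, by rwa [hr]⟩)
      fun h => absurd hwm h
  · refine Finset.sum_eq_add w w.reverse ?_ honly (fun h => absurd hwm h)
      fun h => absurd hrev h
    -- A word with two or more letters that equals its reversal would be both increasing and
    -- decreasing.
    intro hr
    have h2 := List.pairwise_reverse.2 hw
    rw [← hr] at h2
    match w, hl with
    | [], hl => simp at hl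
    | [_], hl => simp at hl
    | a :: b :: l, _ =>
      have h3 := (List.pairwise_cons.1 hw).1 b (by simp)
      have h4 := (List.pairwise_cons.1 h2).1 b (by simp)
      omega

/-- Words that are not monotone have value zero, as have their reversals, and a multiset without a
monotone ordering contributes nothing. What remains is one increasing word for each multiset. -/
theorem sum_words_eq_zero_iff {n : ℕ} {f : Fin n → ℕ} {g : List (Fin n) → F}
    (hg : ∀ w, g w ≠ 0 → w.Pairwise (fun a b => f a < f b) ∨ w.Pairwise fun a b => f b < f a) :
    (∀ m, ∑ w ∈ words m, g w = 0) ↔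
      (∀ w, g w.reverse + g w = 0) ∧ ∀ w, w.length ≤ 1 → g w = 0 := by
  constructor
  · intro h
    have hshort : ∀ w : List (Fin n), w.length ≤ 1 → g w = 0 := by
      intro w hw
      have hm : w ∈ words (Multiset.toFinsupp (w : Multiset (Fin n))) := by simp [mem_words]
      have hp : w.Pairwise fun a b => f a < f b := by
        match w, hw with
        | [], _ => simp
        | [_], _ => simp
      have := sum_words_eq hg hm hp
      rwa [h, if_pos hw, eq_comm] at this
    have hasc : ∀ w : List (Fin n), w.Pairwise (fun a b => f a < f b) →
        g w + g w.reverse = 0 := by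
      intro w hp
      have hm : w ∈ words (Multiset.toFinsupp (w : Multiset (Fin n))) := by simp [mem_words]
      have := sum_words_eq hg hm hp
      rw [h] at this
      split_ifs at this with hl
      · rw [hshort w hl, hshort w.reverse (by simpa using hl), add_zero]
      · exact this.symm
    have hmono : ∀ w : List (Fin n), g w ≠ 0 → g w + g w.reverse = 0 := by
      intro w hw
      rcases hg w hw with hp | hp
      · exact hasc w hp
      · have := hasc w.reverse (List.pairwise_reverse.2 hp)
        rwa [List.reverse_reverse, add_comm] at this
    refine ⟨fun w => ?_, hshort⟩
    by_cases h1 : g w = 0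
    · by_cases h2 : g w.reverse = 0
      · rw [h1, h2, add_zero]
      · have := hmono _ h2
        rwa [List.reverse_reverse] at this
    · rw [add_comm]
      exact hmono _ h1
  · rintro ⟨h1, h2⟩ m
    by_contra hne
    obtain ⟨w, hwm, hw⟩ := Finset.exists_ne_zero_of_sum_ne_zero hne
    have hasc : ∃ w ∈ words m, w.Pairwise fun a b => f a < f b := by
      rcases hg w hw with hp | hp
      · exact ⟨w, hwm, hp⟩
      · refine ⟨w.reverse, ?_, List.pairwise_reverse.2 hp⟩
        rw [mem_words] at hwm ⊢
        rw [hwm]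
        exact (Multiset.coe_eq_coe.2 (List.reverse_perm w)).symm
    obtain ⟨w, hwm, hp⟩ := hasc
    refine hne ?_
    rw [sum_words_eq hg hwm hp]
    split_ifs with hl
    · exact h2 w hl
    · rw [add_comm]
      exact h1 w

end Words

/-! ## The polynomial of a branching program as a sum over words -/

section Paths

variable {F : Type u} {n : ℕ} (P : ABP F n)

/-- There is a path from a node to another one that reads a given word. -/
inductive ABP.Reads : Fin P.size → List (Fin n) → Fin P.size → Prop
  | nil (v : Fin P.size) : Reads v [] v
  | const {u v v' : Fin P.size} {w : List (Fin n)} {a : F} :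
      P.label u v = some (.const a) → Reads v w v' → Reads u w v'
  | var {u v v' : Fin P.size} {w : List (Fin n)} {x : Fin n} :
      P.label u v = some (.var x) → Reads v w v' → Reads u (x :: w) v'

variable {P}

theorem ABP.layer_start : P.layer P.start = 0 := (P.layer_eq_zero_iff _).2 rfl

theorem ABP.layer_terminal : P.layer P.terminal = P.depth := (P.layer_eq_depth_iff _).2 rfl

theorem ABP.Reads.reach {u v : Fin P.size} {w : List (Fin n)} (h : P.Reads u w v) :
    P.Reach u v := by
  induction h with
  | nil v => exact .refl
  | const hl _ ih => exact .head (by simp [ABP.Edge, hl]) ih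
  | var hl _ ih => exact .head (by simp [ABP.Edge, hl]) ih

theorem ABP.Reads.mem_vars {u v : Fin P.size} {w : List (Fin n)} (h : P.Reads u w v) {x : Fin n}
    (hx : x ∈ w) : x ∈ P.vars u v := by
  induction h with
  | nil v => simp at hx
  | const hl _ ih =>
    obtain ⟨a, b, h1, h2, h3⟩ := ih hx
    exact ⟨a, b, .head (by simp [ABP.Edge, hl]) h1, h2, h3⟩
  | var hl hr ih =>
    rcases List.mem_cons.1 hx with rfl | hx
    · exact ⟨_, _, .refl, hl, hr.reach⟩
    · obtain ⟨a, b, h1, h2, h3⟩ := ih hx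
      exact ⟨a, b, .head (by simp [ABP.Edge, hl]) h1, h2, h3⟩

/-- Any cut of the word is realised at a node of the path, which is where disjointness of the
intervals applies. -/
theorem ABP.Reads.split {u v : Fin P.size} {w : List (Fin n)} (h : P.Reads u w v)
    (w₁ w₂ : List (Fin n)) (hw : w = w₁ ++ w₂) : ∃ j, P.Reads u w₁ j ∧ P.Reads j w₂ v := by
  induction h generalizing w₁ with
  | nil v =>
    obtain ⟨rfl, rfl⟩ := List.append_eq_nil_iff.1 hw.symm
    exact ⟨v, .nil v, .nil v⟩
  | const hl _ ih =>
    obtain ⟨j, h1, h2⟩ := ih w₁ hw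
    exact ⟨j, .const hl h1, h2⟩
  | var hl hr ih =>
    rcases w₁ with _ | ⟨y, w₁⟩
    · exact ⟨_, .nil _, by rw [List.nil_append] at hw; exact hw ▸ .var hl hr⟩
    · rw [List.cons_append, List.cons.injEq] at hw
      obtain ⟨rfl, hw⟩ := hw
      obtain ⟨j, h1, h2⟩ := ih w₁ hw
      exact ⟨j, .var hl h1, h2⟩

/-- If neither range of positions ends before the other begins and both contain a position, the
larger of the two left ends lies in both. -/
theorem IsPiInterval.lt_or_gt {π : Equiv.Perm (Fin n)} {I J : Set (Fin n)}
    (hI : IsPiInterval π I) (hJ : IsPiInterval π J) (hd : Disjoint I J) :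
    (∀ a ∈ I, ∀ b ∈ J, (π.symm a : ℕ) < π.symm b) ∨
      ∀ a ∈ I, ∀ b ∈ J, (π.symm b : ℕ) < π.symm a := by
  obtain ⟨i, j, rfl⟩ := hI
  obtain ⟨i', j', rfl⟩ := hJ
  by_cases h1 : j < i'
  · left
    rintro _ ⟨k, h2, h3, rfl⟩ _ ⟨k', h4, h5, rfl⟩
    simp only [Equiv.symm_apply_apply]
    omega
  · by_cases h1' : j' < i
    · right
      rintro _ ⟨k, h2, h3, rfl⟩ _ ⟨k', h4, h5, rfl⟩
      simp only [Equiv.symm_apply_apply]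
      omega
    · left
      rintro _ ⟨k, h2, h3, rfl⟩ _ ⟨k', h4, h5, rfl⟩
      exfalso
      have hlt : max i i' < n := by
        have := k.2
        have := k'.2
        omega
      refine hd.notMem_of_mem_left (a := π ⟨max i i', hlt⟩)
        ⟨⟨max i i', hlt⟩, ?_, ?_, rfl⟩ ⟨⟨max i i', hlt⟩, ?_, ?_, rfl⟩ <;> simp only <;> omega

theorem ABP.IsStrictInterval.pairwise {π : Equiv.Perm (Fin n)} (h : P.IsStrictInterval π)
    {w : List (Fin n)} {u v : Fin P.size} (hw : P.Reads u w v) :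
    w.Pairwise (fun a b => (π.symm a : ℕ) < π.symm b) ∨
      w.Pairwise fun a b => (π.symm b : ℕ) < π.symm a := by
  obtain ⟨-, I, hI, hsub, hdisj⟩ := h
  refine pairwise_lt_or_gt (f := fun a => (π.symm a : ℕ)) fun w₁ w₂ h12 => ?_
  obtain ⟨j, h1, h2⟩ := hw.split w₁ w₂ h12
  have hm₁ : ∀ a ∈ w₁, a ∈ I u j := fun a ha => hsub _ _ (h1.mem_vars ha)
  have hm₂ : ∀ b ∈ w₂, b ∈ I j v := fun b hb => hsub _ _ (h2.mem_vars hb)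
  exact (IsPiInterval.lt_or_gt (hI u j) (hI j v) (hdisj u j v)).imp
    (fun h a ha b hb => h a (hm₁ a ha) b (hm₂ b hb))
    (fun h a ha b hb => h a (hm₁ a ha) b (hm₂ b hb))

end Paths

/-! ### Coefficients of the computed polynomial -/

section Programs

open Matrix

variable {F : Type u} [Field F] {n : ℕ} (P : ABP F n)

/-- The matrix of the constants on the edges of a branching program. -/
def ABP.constEdges : Matrix (Fin P.size) (Fin P.size) F :=
  .of fun u v => labelConst (P.label u v)

/-- The adjacency matrix of the edges of a branching program that carry the variable `x`. -/
def ABP.varEdges (x : ℕ) : Matrix (Fin P.size) (Fin P.size) F :=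
  .of fun u v => if labelKind (P.label u v) = 2 ∧ labelVar (P.label u v) = x then 1 else 0

/-- The weight of a word. -/
def ABP.coeff : List ℕ → F := fun w =>
  coeffMatrix P.constEdges P.varEdges P.depth w P.start P.terminal

variable {P}

theorem constEdges_ne_zero {u v : Fin P.size} (h : P.constEdges u v ≠ 0) :
    ∃ a, P.label u v = some (.const a) := by
  simp only [ABP.constEdges, Matrix.of_apply] at h
  match hl : P.label u v with
  | none => simp [hl, labelConst] at h
  | some (.var _) => simp [hl, labelConst] at h
  | some (.const a) => exact ⟨a, rfl⟩

theorem varEdges_ne_zero {x : ℕ} {u v : Fin P.size} (h : P.varEdges x u v ≠ 0) :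
    ∃ i : Fin n, P.label u v = some (.var i) ∧ (i : ℕ) = x := by
  simp only [ABP.varEdges, Matrix.of_apply] at h
  match hl : P.label u v with
  | none => simp [hl, labelKind] at h
  | some (.const _) => simp [hl, labelKind] at h
  | some (.var i) =>
    refine ⟨i, rfl, ?_⟩
    by_contra hx
    simp [hl, labelVar, hx] at h

/-- Every factor climbs one layer, so the end nodes determine the exponent. -/
theorem coeffMatrix_ne_zero {k : ℕ} {w : List ℕ} {u v : Fin P.size}
    (h : coeffMatrix P.constEdges P.varEdges k w u v ≠ 0) :
    P.layer v = P.layer u + k ∧ ∃ w', w = w'.map Fin.val ∧ P.Reads u w' v := by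
  induction k generalizing u w with
  | zero =>
    rcases w with _ | ⟨x, w⟩
    · have : u = v := by
        by_contra hne
        simp [coeffMatrix, hne] at h
      subst this
      exact ⟨rfl, [], rfl, .nil u⟩
    · simp [coeffMatrix] at h
  | succ k ih =>
    have hconst : ∀ w, (P.constEdges * coeffMatrix P.constEdges P.varEdges k w) u v ≠ 0 →
        P.layer v = P.layer u + (k + 1) ∧ ∃ w', w = w'.map Fin.val ∧ P.Reads u w' v := by
      intro w h
      rw [Matrix.mul_apply] at h
      obtain ⟨j, -, hj⟩ := Finset.exists_ne_zero_of_sum_ne_zero h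
      obtain ⟨a, ha⟩ := constEdges_ne_zero (left_ne_zero_of_mul hj)
      obtain ⟨h1, w', hw, hr⟩ := ih (right_ne_zero_of_mul hj)
      have h2 := P.layer_of_edge u j (by simp [ha])
      exact ⟨by omega, w', hw, .const ha hr⟩
    rcases w with _ | ⟨x, w⟩
    · exact hconst [] h
    · by_cases h1 : (P.constEdges * coeffMatrix P.constEdges P.varEdges k (x :: w)) u v = 0
      · simp only [coeffMatrix, Matrix.add_apply, h1, zero_add] at h
        rw [Matrix.mul_apply] at h
        obtain ⟨j, -, hj⟩ := Finset.exists_ne_zero_of_sum_ne_zero h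
        obtain ⟨i, hi, rfl⟩ := varEdges_ne_zero (left_ne_zero_of_mul hj)
        obtain ⟨h1, w', rfl, hr⟩ := ih (right_ne_zero_of_mul hj)
        have h2 := P.layer_of_edge u j (by simp [hi])
        exact ⟨by omega, i :: w', rfl, .var hi hr⟩
      · exact hconst _ h1

theorem layer_lt_of_constEdges {u v : Fin P.size} (h : P.constEdges u v ≠ 0) :
    P.layer u < P.layer v := by
  obtain ⟨a, ha⟩ := constEdges_ne_zero h
  have := P.layer_of_edge u v (by simp [ha])
  omega

theorem isUnit_one_sub_constEdges : IsUnit (1 - P.constEdges) :=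
  isUnit_one_sub_of_rank fun _ _ => layer_lt_of_constEdges

/-- Between the start and the terminal node only the power `depth` contributes. So the automaton,
which does not count edges, still gives the right weights. -/
theorem wordMatrix_eq_coeff (w : List ℕ) :
    wordMatrix P.constEdges P.varEdges w P.start P.terminal = P.coeff w := by
  have hD : ∀ w, coeffMatrix P.constEdges P.varEdges (P.depth + 1) w = 0 := by
    intro w
    ext u v
    by_contra h
    have h1 := (coeffMatrix_ne_zero h).1
    have h2 := P.layer_le v
    omega
  rw [wordMatrix_eq_sum isUnit_one_sub_constEdges hD, Matrix.sum_apply]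
  refine Finset.sum_eq_single _ (fun k _ hk => ?_) fun h => absurd (by simp) h
  by_contra h
  have h1 := (coeffMatrix_ne_zero h).1
  rw [ABP.layer_start, ABP.layer_terminal] at h1
  omega

theorem ABP.poly_eq_pow :
    P.poly = ((Matrix.of P.edgePoly) ^ P.depth) P.start P.terminal := by
  rw [pow_apply_eq_sum_paths, ABP.poly, Finset.sum_filter]
  refine Finset.sum_congr rfl fun p _ => ?_
  by_cases h : p 0 = P.start ∧ p (Fin.last P.depth) = P.terminal
  · rw [if_pos h]
    split_ifs with hp
    · rfl
    · have : ∃ k : Fin P.depth, ¬ P.Edge (p k.castSucc) (p k.succ) := by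
        by_contra hk
        push Not at hk
        exact hp ⟨h.1, h.2, hk⟩
      obtain ⟨k, hk⟩ := this
      symm
      refine Finset.prod_eq_zero (Finset.mem_univ k) ?_
      simp only [ABP.Edge, ne_eq, not_not] at hk
      simp [ABP.edgePoly, hk]
  · rw [if_neg h, if_neg fun hp => h ⟨hp.1, hp.2.1⟩]

theorem coeff_edgePoly_mul (m : Fin n →₀ ℕ) (u v : Fin P.size) (Q : MvPolynomial (Fin n) F) :
    (P.edgePoly u v * Q).coeff m = P.constEdges u v * Q.coeff m +
      ∑ x : Fin n, P.varEdges x u v *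
        if x ∈ m.support then Q.coeff (m - Finsupp.single x 1) else 0 := by
  simp only [ABP.edgePoly, ABP.constEdges, ABP.varEdges, Matrix.of_apply]
  match P.label u v with
  | none => simp [labelConst, labelKind]
  | some (.const a) => simp [labelConst, labelKind, EdgeLabel.toPoly]
  | some (.var i) =>
    simp [labelConst, labelKind, labelVar, EdgeLabel.toPoly, MvPolynomial.coeff_X_mul', Fin.val_inj]
    rw [Finset.sum_eq_single i]
    · simp
    · intro x _ hx
      simp [Ne.symm hx]
    · simp

/-- Letting the variables commute collects all words with the same letters. The induction removes
the first edge: a constant keeps the monomial, and a variable removes the first letter, as in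
`sum_words`. -/
theorem coeff_pow (k : ℕ) (m : Fin n →₀ ℕ) (u v : Fin P.size) :
    (((Matrix.of P.edgePoly) ^ k) u v).coeff m =
      ∑ w ∈ words m, coeffMatrix P.constEdges P.varEdges k (w.map Fin.val) u v := by
  induction k generalizing u m with
  | zero =>
    have h : ∀ w ∈ words m, w ≠ [] →
        coeffMatrix P.constEdges P.varEdges 0 (w.map Fin.val) u v = 0 := by
      rintro (_ | ⟨x, w⟩) _ hne
      · exact absurd rfl hne
      · rfl
    have hmem : [] ∈ words m ↔ 0 = m := by
      rw [mem_words, Multiset.coe_nil, Finsupp.toMultiset_eq_iff, Multiset.toFinsupp_zero,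
        eq_comm]
    by_cases hm : 0 = m
    · rw [Finset.sum_eq_single [] h fun hn => absurd (hmem.2 hm) hn, ← hm]
      by_cases huv : u = v <;> simp [coeffMatrix, huv]
    · rw [Finset.sum_eq_zero fun w hw => h w hw fun he => hm (hmem.1 (he ▸ hw))]
      by_cases huv : u = v <;> simp [huv, MvPolynomial.coeff_one, hm]
  | succ k ih =>
    let g : List (Fin n) → F
      | [] => 0
      | x :: w => (P.varEdges x * coeffMatrix P.constEdges P.varEdges k (w.map Fin.val)) u v
    have hg : ∀ w : List (Fin n),
        coeffMatrix P.constEdges P.varEdges (k + 1) (w.map Fin.val) u v =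
          (P.constEdges * coeffMatrix P.constEdges P.varEdges k (w.map Fin.val)) u v + g w := by
      rintro (_ | ⟨x, w⟩)
      · simp [coeffMatrix, g]
      · simp [coeffMatrix, g]
    rw [pow_succ', Matrix.mul_apply, MvPolynomial.coeff_sum, Finset.sum_congr rfl fun w _ => hg w,
      Finset.sum_add_distrib, sum_words m g rfl]
    simp only [Matrix.of_apply, coeff_edgePoly_mul, Finset.sum_add_distrib]
    congr 1
    · simp only [Matrix.mul_apply]
      rw [Finset.sum_comm]
      exact Finset.sum_congr rfl fun j _ => by rw [← Finset.mul_sum, ← ih]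
    · rw [Finset.sum_comm]
      refine Finset.sum_congr rfl fun x _ => ?_
      split_ifs
      · simp only [g, Matrix.mul_apply]
        rw [Finset.sum_comm]
        exact Finset.sum_congr rfl fun j _ => by rw [← Finset.mul_sum, ← ih]
      · simp

theorem ABP.coeff_poly (m : Fin n →₀ ℕ) :
    P.poly.coeff m = ∑ w ∈ words m, P.coeff (w.map Fin.val) := by
  rw [ABP.poly_eq_pow, coeff_pow]
  rfl

theorem ABP.IsStrictInterval.poly_eq_zero_iff {π : Equiv.Perm (Fin n)}
    (h : P.IsStrictInterval π) :
    P.poly = 0 ↔ (∀ w, P.coeff w.reverse + P.coeff w = 0) ∧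
      ∀ w, w.length ≤ 1 → P.coeff w = 0 := by
  have hreads : ∀ w, P.coeff w ≠ 0 →
      ∃ w', w = w'.map Fin.val ∧ P.Reads P.start w' P.terminal :=
    fun w hw => (coeffMatrix_ne_zero hw).2
  have hinj : Function.Injective (List.map (Fin.val : Fin n → ℕ)) :=
    List.map_injective_iff.2 Fin.val_injective
  have hmono : ∀ w : List (Fin n), P.coeff (w.map Fin.val) ≠ 0 →
      w.Pairwise (fun a b => (π.symm a : ℕ) < π.symm b) ∨
        w.Pairwise fun a b => (π.symm b : ℕ) < π.symm a := by
    intro w hw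
    obtain ⟨w', hw', hr⟩ := hreads _ hw
    obtain rfl := hinj hw'
    exact h.pairwise hr
  have hpoly : P.poly = 0 ↔ ∀ m : Fin n →₀ ℕ, ∑ w ∈ words m, P.coeff (w.map Fin.val) = 0 := by
    rw [MvPolynomial.ext_iff]
    simp only [ABP.coeff_poly, MvPolynomial.coeff_zero]
  rw [hpoly, sum_words_eq_zero_iff (f := fun a => (π.symm a : ℕ))
    (g := fun w : List (Fin n) => P.coeff (w.map Fin.val)) hmono]
  refine and_congr ⟨fun h1 w => ?_, fun h1 w => ?_⟩ ⟨fun h1 w hw => ?_, fun h1 w hw => ?_⟩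
  · by_cases hn : ∃ w' : List (Fin n), w = w'.map Fin.val
    · obtain ⟨w', rfl⟩ := hn
      rw [← List.map_reverse]
      exact h1 w'
    · have h2 : P.coeff w = 0 := by
        by_contra hne
        obtain ⟨w', hw', -⟩ := hreads _ hne
        exact hn ⟨w', hw'⟩
      have h3 : P.coeff w.reverse = 0 := by
        by_contra hne
        obtain ⟨w', hw', -⟩ := hreads _ hne
        exact hn ⟨w'.reverse, by rw [List.map_reverse, ← hw', List.reverse_reverse]⟩
      rw [h2, h3, add_zero]
  · rw [List.map_reverse]
    exact h1 _
  · by_contra hne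
    obtain ⟨w', rfl, -⟩ := hreads _ hne
    exact hne (h1 w' (by simpa using hw))
  · exact h1 _ (by simpa using hw)

end Programs

/-! ## The algorithm -/

/-- Copy the edge between the nodes in the cells `12` and `13`, and its reversal. -/
def copyEdge : Prog :=
  .seq (.setIdx 7 (cell 12) (cell 13) (.read 2 (cell 12) (cell 13)))
  (.seq (.setIdx 7 (.add (cell 0) (cell 13)) (.add (cell 0) (cell 12))
    (.read 2 (cell 12) (cell 13)))
  (.seq (.setIdx 8 (cell 12) (cell 13) (.read 3 (cell 12) (cell 13)))
  (.seq (.setIdx 8 (.add (cell 0) (cell 13)) (.add (cell 0) (cell 12))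
    (.read 3 (cell 12) (cell 13)))
  (.seq (.setFld 1 (cell 12) (cell 13) (entry 0 12 13))
    (.setFld 1 (.add (cell 0) (cell 13)) (.add (cell 0) (cell 12)) (entry 0 12 13))))))

/-- The disjoint union of the branching program with its reversal. -/
def copyEdges : Prog := forLoop 12 (cell 0) (forLoop 13 (cell 0) copyEdge)

/-- The start node. -/
def startNode : IdxExpr := .read 0 (.const 0) (.const 2)

/-- The terminal node. -/
def terminalNode : IdxExpr := .read 0 (.const 0) (.const 3)

/-- The weighted automaton whose initial states are the start node and the reversed terminal node,
and whose accepting states are the terminal node and the reversed start node. -/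
def buildAutomaton : Prog :=
  .seq (assign 6 (.add (cell 0) (cell 0)))
  (.seq copyEdges
  (.seq (assign 19 terminalNode)
  (.seq (assign 20 (.add (cell 0) startNode))
  (.seq (.setFld 5 startNode (.const 0) .one)
    (.setFld 5 (.add (cell 0) terminalNode) (.const 0) .one)))))

/-- The identity test for strict-interval branching programs. -/
def identityTest : Prog := .seq buildAutomaton zeroTest

/-- The array `g` of size `2 * S` has the entries of `f` with indices in `D` in its upper left
block, their transposes in its lower right block, and zeros in the other two blocks. -/
def Doubles {α : Type*} [Zero α] (S : ℕ) (f : ℕ → ℕ → α) (D : ℕ → ℕ → Prop) (g : ℕ → ℕ → α) :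
    Prop :=
  ∀ i < S, ∀ j < S, (D i j → g i j = f i j ∧ g (S + j) (S + i) = f i j) ∧
    g i (S + j) = 0 ∧ g (S + i) j = 0

theorem Doubles.update {α : Type*} [Zero α] {S a b : ℕ} {f g g' : ℕ → ℕ → α}
    {D D' : ℕ → ℕ → Prop} (h : Doubles S f D g) (ha : a < S) (hb : b < S)
    (hD : ∀ i j, D' i j → D i j ∨ (i = a ∧ j = b))
    (hg : ∀ i j, g' i j = if i = S + b ∧ j = S + a then f a b else
      if i = a ∧ j = b then f a b else g i j) : Doubles S f D' g' := by
  intro i hi j hj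
  refine ⟨fun hd => ?_, ?_, ?_⟩
  · rw [hg, hg, if_neg (by omega)]
    by_cases hij : i = a ∧ j = b
    · obtain ⟨rfl, rfl⟩ := hij
      simp
    · rw [if_neg hij, if_neg (by omega), if_neg (by omega)]
      exact (h i hi j hj).1 ((hD i j hd).resolve_right hij)
  · rw [hg, if_neg (by omega), if_neg (by omega)]
    exact (h i hi j hj).2.1
  · rw [hg, if_neg (by omega), if_neg (by omega)]
    exact (h i hi j hj).2.2

theorem Doubles.mono {α : Type*} [Zero α] {S : ℕ} {f g : ℕ → ℕ → α}
    {D D' : ℕ → ℕ → Prop} (h : Doubles S f D g) (hD : ∀ i < S, ∀ j < S, D' i j → D i j) :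
    Doubles S f D' g :=
  fun i hi j hj => ⟨fun hd => (h i hi j hj).1 (hD i hi j hj hd), (h i hi j hj).2⟩

section Nodes

variable {F : Type u} {n : ℕ} {P : ABP F n}

/-- The numbering of the nodes of a branching program and its reversal. -/
def ABP.nodes (P : ABP F n) : Fin (P.size + P.size) ≃ Fin P.size ⊕ Fin P.size :=
  finSumFinEquiv.symm

@[simp] theorem ABP.nodes_symm_inl (i : Fin P.size) : (P.nodes.symm (Sum.inl i) : ℕ) = i := rfl

@[simp] theorem ABP.nodes_symm_inr (i : Fin P.size) :
    (P.nodes.symm (Sum.inr i) : ℕ) = P.size + i := rfl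

end Nodes

/-! ### Correctness of the identity test -/

section Algorithm

open Matrix

variable {F : Type u} [Field F]

/-- The edges with indices in `D` have been copied. -/
structure Copied (S : ℕ) (m : Memory F) (D : ℕ → ℕ → Prop) (m' : Memory F) : Prop where
  kind : Doubles S (m.idx 2) D (m'.idx 7)
  var : Doubles S (m.idx 3) D (m'.idx 8)
  const : Doubles S (m.fld 0) D (m'.fld 1)

theorem Copied.mono {S : ℕ} {m m' : Memory F} {D D' : ℕ → ℕ → Prop} (h : Copied S m D m')
    (hD : ∀ i < S, ∀ j < S, D' i j → D i j) : Copied S m D' m' :=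
  ⟨h.kind.mono hD, h.var.mono hD, h.const.mono hD⟩

/-- The off-diagonal blocks are never written; they are zero because the target arrays are zero
initially. -/
theorem spec_copyEdges {N S : ℕ} (hSN : S ≤ N) {m : Memory F} (hS : m.idx 0 0 0 = S)
    (h7 : m.idx 7 = 0) (h8 : m.idx 8 = 0) (h1 : m.fld 1 = 0) :
    Spec N copyEdges m (fun m' => Frame [7, 8, 12, 13] [1] m m' ∧
      Copied S m (fun _ _ => True) m') := by
  refine (Spec.forLoop hSN (fun a m' => Frame [7, 8, 12, 13] [1] m m' ∧
    Copied S m (fun i _ => i < a) m')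
    ⟨(Frame.refl _ _ _).setIdx _ _ _, ?_, ?_, ?_⟩ ?_ ?_).mono
      fun m' h => ⟨h.1, h.2.mono fun i hi _ _ _ => hi⟩
  · intro i _ j _
    simp [h7]
  · intro i _ j _
    simp [h8]
  · intro i _ j _
    simp [h1]
  · rintro i m' ⟨hF, -⟩
    rw [eval_cell, hF.idx 0, hS]
  rintro a ha m₁ ⟨hF₁, hC₁⟩ hc
  refine (Spec.forLoop hSN (fun b m₂ => Frame [7, 8, 13] [1] m₁ m₂ ∧
    Copied S m (fun i j => i < a ∨ (i = a ∧ j < b)) m₂)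
    ⟨(Frame.refl _ _ _).setIdx _ _ _, ?_⟩ ?_ ?_).mono ?_
  · have h : Copied S m (fun i j => i < a ∨ (i = a ∧ j < 0)) m₁ :=
      hC₁.mono fun i _ j _ h => by omega
    exact ⟨h.kind, h.var, h.const⟩
  · rintro i m' ⟨hF, -⟩
    rw [eval_cell, hF.idx 0, hF₁.idx 0, hS]
  · rintro b hb m₂ ⟨hF₂, hC₂⟩ hc'
    have hF := hF₁.trans hF₂
    have hD : ∀ i j, i < a ∨ (i = a ∧ j < b + 1) → (i < a ∨ (i = a ∧ j < b)) ∨ (i = a ∧ j = b) :=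
      fun i j h => by omega
    have hc₂ : m₂.idx 12 0 0 = a := by rw [hF₂.idx 12, hc]
    have hS₂ : m₂.idx 0 0 0 = S := by rw [hF.idx 0, hS]
    refine Spec.seq (Spec.setIdx (Spec.seq (Spec.setIdx (Spec.seq (Spec.setIdx (Spec.seq
      (Spec.setIdx (Spec.seq (Spec.setFld (Spec.setFld ⟨?_, ?_, ?_, ?_, ?_⟩))))))))))
    · simpa using hc'
    · exact (((((((hF₂.setIdx _ _ _).setIdx _ _ _).setIdx _ _ _).setIdx _ _ _).setFld
        _ _ _).setFld _ _ _).setIdx _ _ _)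
    · refine hC₂.kind.update ha hb hD fun i j => ?_
      simp [IdxExpr.eval, hc₂, hc', hS₂, hF.idx 2]
    · refine hC₂.var.update ha hb hD fun i j => ?_
      simp [IdxExpr.eval, hc₂, hc', hS₂, hF.idx 3]
    · refine hC₂.const.update ha hb hD fun i j => ?_
      simp [IdxExpr.eval, FldExpr.eval, entry, hc₂, hc', hS₂, hF.fld 0]
  · rintro m₂ ⟨hF₂, hC₂⟩
    have h : Copied S m (fun i _ => i < a + 1) m₂ := hC₂.mono fun i _ j _ h => by omega
    exact ⟨by rw [hF₂.idx 12, hc], (hF₁.trans hF₂).setIdx _ _ _, h.kind, h.var, h.const⟩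

variable {n : ℕ} {P : ABP F n} {π : Equiv.Perm (Fin n)}

/-- The matrix of the constants of a branching program and its reversal. -/
def ABP.doubleConst (P : ABP F n) : Matrix (Fin P.size ⊕ Fin P.size) (Fin P.size ⊕ Fin P.size) F :=
  fromBlocks P.constEdges 0 0 P.constEdgesᵀ

/-- The matrix of the variable `x` in a branching program and its reversal. -/
def ABP.doubleVar (P : ABP F n) (x : ℕ) :
    Matrix (Fin P.size ⊕ Fin P.size) (Fin P.size ⊕ Fin P.size) F :=
  fromBlocks (P.varEdges x) 0 0 (P.varEdges x)ᵀ

/-- The initial vector of a branching program and its reversal. -/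
def ABP.doubleInit (P : ABP F n) : Fin P.size ⊕ Fin P.size → F :=
  Sum.elim (Pi.single P.start 1) (Pi.single P.terminal 1)

theorem spec_buildAutomaton :
    Spec (P.size + P.size) buildAutomaton (inputMemory P π) (fun m =>
      HoldsAutomaton (P.doubleConst.submatrix P.nodes P.nodes)
        (fun x => (P.doubleVar x).submatrix P.nodes P.nodes)
        (P.nodes.symm (Sum.inl P.terminal)) (P.nodes.symm (Sum.inr P.start)) m ∧
      vec (P.size + P.size) m 5 = P.doubleInit ∘ P.nodes ∧
      m.idx 0 0 2 = P.nodes.symm (Sum.inl P.start)) := by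
  refine Spec.seq (Spec.assign (Spec.seq ((spec_copyEdges (S := P.size) (by omega)
    rfl rfl rfl rfl).mono ?_)))
  rintro m ⟨hF, hC⟩
  have h0 : m.idx 0 = (inputMemory P π).idx 0 := hF.idx 0
  have h00 : m.idx 0 0 0 = P.size := by rw [h0]; rfl
  have h02 : m.idx 0 0 2 = P.start := by rw [h0]; rfl
  have h03 : m.idx 0 0 3 = P.terminal := by rw [h0]; rfl
  have h6 : m.idx 6 0 0 = P.size + P.size := by rw [hF.idx 6]; rfl
  have h5 : m.fld 5 = 0 := hF.fld 5
  have hkind : ∀ i j : Fin P.size, (inputMemory P π).idx 2 i j = labelKind (P.label i j) :=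
    fun i j => by simp [inputMemory]
  have hvar : ∀ i j : Fin P.size, (inputMemory P π).idx 3 i j = labelVar (P.label i j) :=
    fun i j => by simp [inputMemory]
  have hconst : ∀ i j : Fin P.size, (inputMemory P π).fld 0 i j = labelConst (P.label i j) :=
    fun i j => by simp [inputMemory]
  refine Spec.seq (Spec.assign (Spec.seq (Spec.assign (Spec.seq (Spec.setFld (Spec.setFld
    ⟨⟨?_, ?_, ?_, ?_, ?_⟩, ?_, ?_⟩))))))
  · simpa using h6
  · ext u v
    obtain ⟨u, rfl⟩ := P.nodes.symm.surjective u
    obtain ⟨v, rfl⟩ := P.nodes.symm.surjective v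
    rcases u with i | i <;> rcases v with j | j
    · have := ((hC.const i i.2 j j.2).1 trivial).1
      simpa [constMatrix, ABP.doubleConst, ABP.constEdges] using this.trans (hconst i j)
    · have := (hC.const i i.2 j j.2).2.1
      simpa [constMatrix, ABP.doubleConst] using this
    · have := (hC.const i i.2 j j.2).2.2
      simpa [constMatrix, ABP.doubleConst] using this
    · have := ((hC.const j j.2 i i.2).1 trivial).2
      simpa [constMatrix, ABP.doubleConst, ABP.constEdges] using this.trans (hconst j i)
  · ext x u v
    obtain ⟨u, rfl⟩ := P.nodes.symm.surjective u
    obtain ⟨v, rfl⟩ := P.nodes.symm.surjective v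
    rcases u with i | i <;> rcases v with j | j
    · have h1 := ((hC.kind i i.2 j j.2).1 trivial).1.trans (hkind i j)
      have h2 := ((hC.var i i.2 j j.2).1 trivial).1.trans (hvar i j)
      simp [varMatrix, ABP.doubleVar, ABP.varEdges, h1, h2]
    · have h1 := (hC.kind i i.2 j j.2).2.1
      simp [varMatrix, ABP.doubleVar, h1]
    · have h1 := (hC.kind i i.2 j j.2).2.2
      simp [varMatrix, ABP.doubleVar, h1]
    · have h1 := ((hC.kind j j.2 i i.2).1 trivial).2.trans (hkind j i)
      have h2 := ((hC.var j j.2 i i.2).1 trivial).2.trans (hvar j i)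
      simp [varMatrix, ABP.doubleVar, ABP.varEdges, h1, h2]
  · simp [IdxExpr.eval, terminalNode, h03]
  · simp [IdxExpr.eval, startNode, h00, h02]
  · funext u
    obtain ⟨u, rfl⟩ := P.nodes.symm.surjective u
    rcases u with i | i
    · have : (i : ℕ) ≠ P.size + P.terminal := by omega
      simp [vec, IdxExpr.eval, FldExpr.eval, startNode, terminalNode, h00, h02, h03,
        ABP.doubleInit, h5, this, Pi.single_apply, Fin.val_inj]
    · have : P.size + (i : ℕ) ≠ P.start := by omega
      simp [vec, IdxExpr.eval, FldExpr.eval, startNode, terminalNode, h00, h02, h03,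
        ABP.doubleInit, h5, this, Pi.single_apply, Fin.val_inj]
  · simp [h02]

/-- Reversal turns the layering upside down; the subtraction does not truncate, as no layer exceeds
`depth`. -/
theorem doubleConst_rank {u v : Fin P.size ⊕ Fin P.size} (h : P.doubleConst u v ≠ 0) :
    Sum.elim P.layer (fun i => P.depth - P.layer i) u <
      Sum.elim P.layer (fun i => P.depth - P.layer i) v := by
  rcases u with i | i <;> rcases v with j | j
  · exact layer_lt_of_constEdges h
  · exact absurd rfl h
  · exact absurd rfl h
  · have h1 : P.layer j < P.layer i := layer_lt_of_constEdges h
    have h2 := P.layer_le i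
    simp only [Sum.elim_inr]
    omega

/-- No edge enters the start node, which lies in layer `0`. This provides the pivot of the first
basis row. -/
theorem wordMatrix_start : wordMatrix P.constEdges P.varEdges [] P.start P.start = 1 := by
  have h := congr_fun (vecMul_inv_one_sub isUnit_one_sub_constEdges
    (Pi.single P.start 1 : Fin P.size → F)) P.start
  rw [Pi.add_apply, Pi.single_eq_same, Matrix.single_one_vecMul] at h
  rw [wordMatrix]
  refine h.trans (add_eq_left.2 ?_)
  rw [Matrix.vecMul, dotProduct]
  refine Finset.sum_eq_zero fun u _ => ?_
  by_cases hu : P.constEdges u P.start = 0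
  · rw [hu, mul_zero]
  · have := layer_lt_of_constEdges hu
    rw [ABP.layer_start] at this
    omega

theorem spec_identityTest (h : P.IsStrictInterval π) :
    Spec (P.size + P.size) identityTest (inputMemory P π) (fun m =>
      (P.poly = 0 → m.output = 1) ∧ (P.poly ≠ 0 → m.output = 0)) := by
  refine Spec.seq (spec_buildAutomaton.mono ?_)
  rintro m ⟨hA, hz, hs⟩
  refine (spec_zeroTest hA (rk := Sum.elim P.layer (fun i => P.depth - P.layer i) ∘ P.nodes)
    (fun u v huv => doubleConst_rank huv) hz hs ?_).mono ?_
  · rw [stateVec_submatrix, ABP.doubleConst, ABP.doubleInit]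
    unfold ABP.doubleVar
    rw [stateVec_fromBlocks isUnit_one_sub_constEdges]
    simpa using wordMatrix_start
  · have hv : Vanishes (P.doubleConst.submatrix P.nodes P.nodes)
        (fun x => (P.doubleVar x).submatrix P.nodes P.nodes) (P.doubleInit ∘ P.nodes)
        (P.nodes.symm (Sum.inl P.terminal)) (P.nodes.symm (Sum.inr P.start)) ↔ P.poly = 0 := by
      rw [vanishes_submatrix, h.poly_eq_zero_iff]
      simp only [← wordMatrix_eq_coeff]
      exact vanishes_fromBlocks isUnit_one_sub_constEdges P.start P.terminal
    rw [hv]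
    rintro m' (⟨h1, h2⟩ | ⟨h1, h2⟩)
    · exact ⟨fun _ => h1, fun h3 => absurd h2 h3⟩
    · exact ⟨fun h3 => absurd h3 h2, fun _ => h1⟩

end Algorithm

end StrictIntervalABP

theorem mainTheorem6 :
    ∃ (A : StrictIntervalABP.Prog) (q : Polynomial ℕ),
      ∀ (F : Type u) [Field F] (n : ℕ) (P : StrictIntervalABP.ABP F n)
        (π : Equiv.Perm (Fin n)), P.IsStrictInterval π →
        ∃ (T : ℕ) (m : StrictIntervalABP.Memory F),
          StrictIntervalABP.Runs A (StrictIntervalABP.inputMemory P π) T m ∧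
          T ≤ q.eval P.size ∧
          (P.poly = 0 → m.output = 1) ∧
          (P.poly ≠ 0 → m.output = 0) := by
  refine ⟨StrictIntervalABP.identityTest,
    -- The doubled automaton has `P.size + P.size` states, which bounds the iterations of every
    -- loop.
    StrictIntervalABP.identityTest.time.comp (Polynomial.X + Polynomial.X),
    fun F _ n P π h => ?_⟩
  obtain ⟨T, m, hr, ht, hq⟩ := StrictIntervalABP.spec_identityTest h
  exact ⟨T, m, hr, by simpa using ht, hq⟩
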